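/- Setting. Let $m=(m_0,m_1,\dots)$ be a sequence of integers $\ge 2$, $M_0:=1$, $M_{k+1}:=m_kM_k$, and let $G_m=\prod_k Z_{m_k}$ carry the product $\mu$ of the uniform probability measures on $Z_{m_k}=\{0,\dots,m_k-1\}$. Put $I_n(x)=\{y: y_i=x_i,\ i<n\}$ and let $\mathcal F_n$ be the $\sigma$-algebra generated by the sets $I_n(x)$. Write $n=\sum_j n_jM_j$ with $0\le n_j<m_j$ and, for $n\ge1$, $\langle n\rangle=\min\{j:n_j\ne0\}$, $|n|=\max\{j:n_j\ne0\}$, $\rho(n)=|n|-\langle n\rangle$ (with $\langle 0\rangle=|0|=0$). Let $\psi_n(x)=\prod_k \exp(2\pi i x_k/m_k)^{n_k}$ be the Vilenkin system. For a (complex) martingale $f=(f_n)$ with respect to $(\mathcal F_n)$ let $\widehat f(i)=\lim_k\int f_k\overline{\psi_i}\,d\mu$, $S_nf=\sum_{i<n}\widehat f(i)\psi_i$, $\|f\|_{H_p}=\|\sup_n|f_n|\|_p$, and let $f\in H_p$ mean $\|f\|_{H_p}<\infty$; an integrable function $g$ is identified with the martingale $(S_{M_l}g)_l$. Put $\omega(1/M_n,f)_{H_p}=\|f-S_{M_n}f\|_{H_p}$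 and $\|g\|_{L_{p,\infty}}=\sup_{t>0}t\,\mu(|g|>t)^{1/p}$. Theorem. Let $0<p<1$. (a) Suppose that $m$ is bounded. There is a constant $c$, depending only on $p$ and on an upper bound for the $m_j$, such that for every $f\in H_p$ and all $k,n$ with $M_k<n\le M_{k+1}$, $$\|S_nf-f\|_{H_p}\le c\left(\frac{M_{|n|}}{M_{\langle n\rangle}}\right)^{1/p-1}\omega\left(\frac1{M_k},f\right)_{H_p}.$$ Moreover, if $f\in H_p$ and $(n_k)$ is a (strictly) increasing sequence of nonnegative integers with $$\omega\left(\frac1{M_{|n_k|}},f\right)_{H_p}=o\left(\left(\frac{M_{\langle n_k\rangle}}{M_{|n_k|}}\right)^{1/p-1}\right)\quad(k\to\infty),$$ then $\|S_{n_k}f-f\|_{H_p}\to0$ as $k\to\infty$. (b) Let $m$ be arbitrary (bounded or not) and let $(n_k)$ be a (strictly) increasing sequence of nonnegative integers with $\sup_k\rho(n_k)=\infty$. Then there are a martingale $f=(f_l)\in H_p$, converging almost everywhere to a function which is again denoted by $f$, and a subsequence $(\alpha_k)$ of $(n_k)$, such that $$\omega\left(\frac1{M_{|\alpha_k|}},f\right)_{H_p}=O\left(\left(\frac{M_{\langle\alpha_k\rangle}}{M_{|\alpha_k|}}\right)^{1/p-1}\right)\quad(k\to\infty)$$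 and, for some constant $c>0$, $$\limsup_{k\to\infty}\|S_{\alpha_k}f-f\|_{L_{p,\infty}}>c>0 .$$ -/

import Mathlib

open MeasureTheory ProbabilityTheory Filter Topology
open scoped ENNReal NNReal ComplexConjugate

namespace Vilenkin

/-- `m` generates a Vilenkin system: a sequence of integers not less than `2`. -/
class Generator (m : ℕ → ℕ) : Prop where
  two_le : ∀ k, 2 ≤ m k

/-- The Vilenkin group `G_m = ∏ Z_{m_k}`, with its product σ-algebra. -/
abbrev G (m : ℕ → ℕ) : Type := (k : ℕ) → Fin (m k)

/-- The generalized powers `M 0 = 1`, `M (k+1) = m k * M k`. -/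
def M (m : ℕ → ℕ) : ℕ → ℕ
  | 0 => 1
  | k + 1 => m k * M m k

/-- The `j`-th digit `n_j` in the expansion `n = ∑ n_j M_j`, `0 ≤ n_j < m_j`. -/
def digit (m : ℕ → ℕ) (n j : ℕ) : ℕ := n / M m j % m j

/-- `⟨n⟩`, the least index of a nonzero digit (for `n ≠ 0`). -/
noncomputable def lo (m : ℕ → ℕ) (n : ℕ) : ℕ := sInf {j | digit m n j ≠ 0}

/-- `|n|`, the greatest index of a nonzero digit (for `n ≠ 0`). -/
noncomputable def hi (m : ℕ → ℕ) (n : ℕ) : ℕ := sSup {j | digit m n j ≠ 0}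

/-- `ρ(n) = |n| - ⟨n⟩`. -/
noncomputable def rho (m : ℕ → ℕ) (n : ℕ) : ℕ := hi m n - lo m n

lemma two_pow_le_M (m : ℕ → ℕ) [Generator m] (k : ℕ) : 2 ^ k ≤ M m k := by
  induction k with
  | zero => simp [M]
  | succ k ih =>
    rw [pow_succ, M, mul_comm]
    exact Nat.mul_le_mul (Generator.two_le k) ih

/-- Only digits with index below `n` can be nonzero. -/
lemma digit_eq_zero (m : ℕ → ℕ) [Generator m] {n j : ℕ} (h : n ≤ j) : digit m n j = 0 := by
  have : n < M m j := lt_of_lt_of_le (lt_of_le_of_lt h Nat.lt_two_pow_self) (two_pow_le_M m j)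
  simp [digit, Nat.div_eq_of_lt this]

lemma bddAbove_digit_ne_zero (m : ℕ → ℕ) [Generator m] (n : ℕ) :
    BddAbove {j | digit m n j ≠ 0} :=
  ⟨n, fun _ hj => le_of_not_ge fun h => hj (digit_eq_zero m h)⟩

instance nonempty_fin (m : ℕ → ℕ) [Generator m] (k : ℕ) : Nonempty (Fin (m k)) :=
  ⟨⟨0, lt_of_lt_of_le two_pos (Generator.two_le k)⟩⟩

/-- The normalized Haar measure on `G m`: the product of the uniform measures on `Z_{m_k}`. -/
noncomputable def haar (m : ℕ → ℕ) [Generator m] : Measure (G m) :=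
  Measure.infinitePi fun k => (uniformOn Set.univ : Measure (Fin (m k)))

instance (m : ℕ → ℕ) [Generator m] : IsProbabilityMeasure (haar m) := by
  unfold haar; infer_instance

/-- The interval `I_n(x)`. -/
def I (m : ℕ → ℕ) (n : ℕ) (x : G m) : Set (G m) := {y | ∀ i < n, y i = x i}

/-- The σ-algebra generated by the intervals `I_n(x)`, `x ∈ G m`. -/
@[reducible] def sigmaI (m : ℕ → ℕ) (n : ℕ) : MeasurableSpace (G m) :=
  MeasurableSpace.generateFrom {s | ∃ x, s = I m n x}

lemma measurableSet_I (m : ℕ → ℕ) (n : ℕ) (x : G m) : MeasurableSet (I m n x) := by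
  have : I m n x = ⋂ i, ⋂ (_ : i < n), (fun y : G m => y i) ⁻¹' {x i} := by
    ext y; simp [I]
  rw [this]
  exact MeasurableSet.iInter fun i => MeasurableSet.iInter fun _ =>
    measurable_pi_apply i (MeasurableSet.singleton _)

lemma sigmaI_mono (m : ℕ → ℕ) : Monotone (sigmaI m) := by
  intro a b hab
  apply MeasurableSpace.generateFrom_le
  rintro _ ⟨x, rfl⟩
  let S : Set (Set (G m)) := {s | ∃ y ∈ I m a x, s = I m b y}
  have hS : I m a x = ⋃₀ S := by
    ext z
    constructor
    · intro hz
      exact ⟨I m b z, ⟨z, hz, rfl⟩, fun i _ => rfl⟩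
    · rintro ⟨_, ⟨y, hy, rfl⟩, hz⟩ i hi
      rw [hz i (lt_of_lt_of_le hi hab), hy i hi]
  have hfin : S.Finite := by
    refine (Set.finite_range fun u : (i : Fin b) → Fin (m i) =>
      {z : G m | ∀ i : Fin b, z i = u i}).subset ?_
    rintro _ ⟨y, _, rfl⟩
    refine ⟨fun i => y i, ?_⟩
    ext z
    exact ⟨fun h i hi => h ⟨i, hi⟩, fun h i => h i i.2⟩
  rw [hS]
  refine @MeasurableSet.sUnion _ (sigmaI m b) _ hfin.countable ?_
  rintro _ ⟨y, _, rfl⟩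
  exact MeasurableSpace.measurableSet_generateFrom ⟨y, rfl⟩

/-- The filtration `(F_n)` of `G m`. -/
def filtration (m : ℕ → ℕ) : Filtration ℕ (inferInstance : MeasurableSpace (G m)) where
  seq := sigmaI m
  mono' := sigmaI_mono m
  le' n := by
    apply MeasurableSpace.generateFrom_le
    rintro _ ⟨x, rfl⟩
    exact measurableSet_I m n x

/-- The generalized Rademacher functions `r_k(x) = exp(2πi x_k / m_k)`. -/
noncomputable def rademacher (m : ℕ → ℕ) (k : ℕ) (x : G m) : ℂ :=
  Complex.exp (2 * Real.pi * Complex.I * ((x k : ℕ) : ℂ) / (m k : ℂ))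

/-- The Vilenkin functions `ψ_n = ∏_k r_k ^ n_k`; the factors with `k ≥ n` equal `1` by
`digit_eq_zero`. -/
noncomputable def psi (m : ℕ → ℕ) (n : ℕ) (x : G m) : ℂ :=
  ∏ k ∈ Finset.range n, rademacher m k x ^ digit m n k

/-- Vilenkin-Fourier coefficients of an integrable function. -/
noncomputable def coeff (m : ℕ → ℕ) [Generator m] (g : G m → ℂ) (i : ℕ) : ℂ :=
  ∫ x, g x * conj (psi m i x) ∂(haar m)

/-- Vilenkin-Fourier coefficients of a martingale `f = (f_k)`: the limit of the coefficients of
the `f_k` (which are eventually constant in `k`). -/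
noncomputable def martCoeff (m : ℕ → ℕ) [Generator m] (f : ℕ → G m → ℂ) (i : ℕ) : ℂ :=
  limUnder atTop fun k => coeff m (f k) i

/-- The partial sum `S_n g` of the Vilenkin-Fourier series of a function `g`. -/
noncomputable def SFun (m : ℕ → ℕ) [Generator m] (n : ℕ) (g : G m → ℂ) (x : G m) : ℂ :=
  ∑ i ∈ Finset.range n, coeff m g i * psi m i x

/-- The partial sum `S_n f` of the Vilenkin-Fourier series of a martingale `f`. -/
noncomputable def S (m : ℕ → ℕ) [Generator m] (n : ℕ) (f : ℕ → G m → ℂ) (x : G m) : ℂ :=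
  ∑ i ∈ Finset.range n, martCoeff m f i * psi m i x

/-- The martingale `(S_{M_l} g)_l` obtained from an integrable function `g`. -/
noncomputable def toMart (m : ℕ → ℕ) [Generator m] (g : G m → ℂ) (l : ℕ) : G m → ℂ :=
  SFun m (M m l) g

/-- `‖f‖_{H_p} = ‖f^*‖_p`, where `f^* = sup_l |f_l|`, with values in `[0, ∞]`. -/
noncomputable def hpNorm (m : ℕ → ℕ) [Generator m] (p : ℝ) (f : ℕ → G m → ℂ) : ℝ≥0∞ :=
  (∫⁻ x, (⨆ l, ‖f l x‖ₑ) ^ p ∂(haar m)) ^ (1 / p)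

/-- The martingale Hardy space `H_p(G_m)`. -/
def MemHp (m : ℕ → ℕ) [Generator m] (p : ℝ) (f : ℕ → G m → ℂ) : Prop :=
  Martingale f (filtration m) (haar m) ∧ hpNorm m p f < ∞

/-- `‖S_n f - f‖_{H_p}`, the function `S_n f` being identified with the martingale it generates. -/
noncomputable def errHp (m : ℕ → ℕ) [Generator m] (p : ℝ) (n : ℕ) (f : ℕ → G m → ℂ) : ℝ≥0∞ :=
  hpNorm m p (toMart m (S m n f) - f)

/-- The modulus of continuity `ω(1/M_n, f)_{H_p} = ‖f - S_{M_n} f‖_{H_p}`. -/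
noncomputable def omega (m : ℕ → ℕ) [Generator m] (p : ℝ) (n : ℕ) (f : ℕ → G m → ℂ) : ℝ≥0∞ :=
  hpNorm m p (f - toMart m (S m (M m n) f))

/-- The weak quasi-norm `‖g‖_{L_{p,∞}} = sup_{t > 0} t μ(|g| > t)^{1/p}` of a function. -/
noncomputable def weakNorm (m : ℕ → ℕ) [Generator m] (p : ℝ) (g : G m → ℂ) : ℝ≥0∞ :=
  ⨆ t : ℝ≥0, (t : ℝ≥0∞) * haar m {x | (t : ℝ≥0∞) < ‖g x‖ₑ} ^ (1 / p)

/-- `(M_{|n|} / M_{⟨n⟩})^{1/p-1}`. -/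
noncomputable def ratio (m : ℕ → ℕ) (p : ℝ) (n : ℕ) : ℝ≥0∞ :=
  ((M m (hi m n) : ℝ≥0∞) / (M m (lo m n) : ℝ≥0∞)) ^ (1 / p - 1)

end Vilenkin

namespace Vilenkin

/-! ### Digits in the mixed radix expansion -/

section Digits

/-! Everything rests on the Dirichlet kernel `D_n(x,y) = ∑_{i<n} ψ_i(x) conj(ψ_i(y))`. For `n = M_j`
it is `M_j` times the indicator of `y ∈ I_j(x)`. For general `n`, splitting off the digits one by
one bounds it by `∑_{j ≥ ⟨n⟩} m_j M_j 1_{I_j(x)}(y)`.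

Upper estimate. For `M_k < n ≤ M_{k+1}` put `h = S_{M_{k+1}} f - S_{M_k} f`. Then `S_n f - S_{M_k} f
= S_n h`, so `|S_n h(x)|` is at most a constant times `∑_{⟨n⟩ ≤ j ≤ k+1} M_j ∫_{I_j(x)} |h|`. Since
`h` is constant on intervals of order `K = k+1`, a reverse Hölder inequality
(`setLIntegral_rpow_le`) gives `(∫_{I_j} |h|)^p ≤ M_K^{1-p} ∫_{I_j} |h|^p`. Integrating in `x`, the
`j`-th term costs `(M_K/M_j)^{1-p}`; these numbers decay geometrically in `j`, so the term `j = ⟨n⟩`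
dominates (`lintegral_enorm_psum_rpow_le`). The maximal function of `S_n f - f` is at most `|S_n h|`
plus the maximal function of `f - S_{M_k} f`, whence `errHp_le`. The convergence statement follows
with `k = |n|`; there `n = M_{|n|}` is a separate, trivial case.

Counterexample. Pass to a subsequence `α_k` along which `(M_⟨α_k⟩/M_{|α_k|})^{1-p}` at least halves
at each step. Let `f` be the sum of the blocks `w_k ∑ ψ_i`, with `i` running over the numbers below
`M_{|α_k|+1}` having the same digit at `|α_k|` as `α_k`, and `w_k = M_⟨α_k⟩^{1/p-1}`. A block has
modulus `w_k M_{|α_k|}` on `I_{|α_k|}(0)` and vanishes elsewhere. Its `p`-th power integral is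
exactly `(M_⟨α_k⟩/M_{|α_k|})^{1-p}`, so the tails give the bound on the modulus of continuity. A
block has length `M_{|α_k|}`, not `M_{|α_k|+1}`, so its size does not involve `m_{|α_k|}` and no
bound on `m` is needed.

Outside `I_{|α_k|}(0)` the limit `F` equals `S_{M_{|α_k|}} f`, and `S_{α_k} f - F = w_k
D_{α_k}(·,0)`. By `le_norm_dirichlet` and `le_haar_lower_set` this kernel is at least `M_⟨α_k⟩/2` on
a set of measure at least `1/(3 M_⟨α_k⟩)`, so the weak norm stays away from zero. -/

lemma M_pos (m : ℕ → ℕ) [Generator m] (k : ℕ) : 0 < M m k :=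
  lt_of_lt_of_le (by positivity) (two_pow_le_M m k)

lemma M_dvd (m : ℕ → ℕ) {j k : ℕ} (h : j ≤ k) : M m j ∣ M m k := by
  induction k, h using Nat.le_induction with
  | base => exact dvd_rfl
  | succ k _ ih => exact ih.trans (Dvd.intro_left _ rfl)

lemma M_mono (m : ℕ → ℕ) [Generator m] : Monotone (M m) :=
  fun _ k h => Nat.le_of_dvd (M_pos m k) (M_dvd m h)

lemma M_mul_two_pow_le (m : ℕ → ℕ) [Generator m] (j t : ℕ) : M m j * 2 ^ t ≤ M m (j + t) := by
  induction t with
  | zero => simp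
  | succ t ih =>
    have h2 : 2 ≤ m (j + t) := Generator.two_le _
    rw [← add_assoc, M, pow_succ]
    nlinarith

lemma lt_M (m : ℕ → ℕ) [Generator m] (n : ℕ) : n < M m n :=
  lt_of_lt_of_le Nat.lt_two_pow_self (two_pow_le_M m n)

lemma digit_eq_zero_of_lt (m : ℕ → ℕ) [Generator m] {n k : ℕ} (h : n < M m k) : digit m n k = 0 := by
  simp [digit, Nat.div_eq_of_lt h]

lemma digit_eq_zero_of_dvd (m : ℕ → ℕ) [Generator m] {n j k : ℕ} (h : M m j ∣ n) (hk : k < j) :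
    digit m n k = 0 := by
  obtain ⟨c, hc⟩ := (M_dvd m (Nat.succ_le_of_lt hk)).trans h
  rw [Nat.succ_eq_add_one, M] at hc
  rw [digit, hc, show m k * M m k * c = M m k * (m k * c) by ring,
    Nat.mul_div_cancel_left _ (M_pos m k)]
  simp

lemma digit_mul_M_add (m : ℕ → ℕ) [Generator m] (a : ℕ) {j r : ℕ} (hr : r < M m j) (k : ℕ) :
    digit m (a * M m j + r) k = digit m (a * M m j) k + digit m r k := by
  rcases lt_or_ge k j with hk | hk
  · rw [digit_eq_zero_of_dvd m (Dvd.intro_left _ rfl : M m j ∣ a * M m j) hk, zero_add]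
    obtain ⟨c, hc⟩ := M_dvd m (Nat.succ_le_of_lt hk)
    rw [Nat.succ_eq_add_one, M] at hc
    rw [digit, digit, hc, show a * (m k * M m k * c) + r = r + M m k * (m k * (c * a)) by ring,
      Nat.add_mul_div_left _ _ (M_pos m k), Nat.add_mul_mod_self_left]
  · rw [digit_eq_zero_of_lt m (hr.trans_le (M_mono m hk)), add_zero]
    obtain ⟨c, hc⟩ := M_dvd m hk
    rw [digit, digit, hc, ← Nat.div_div_eq_div_mul, ← Nat.div_div_eq_div_mul,
      Nat.mul_div_cancel _ (M_pos m j), mul_comm a, Nat.mul_add_div (M_pos m j),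
      Nat.div_eq_of_lt hr, add_zero]

lemma digit_mul_M (m : ℕ → ℕ) [Generator m] {a j : ℕ} (ha : a < m j) (k : ℕ) :
    digit m (a * M m j) k = if k = j then a else 0 := by
  split_ifs with h
  · subst h
    rw [digit, Nat.mul_div_cancel _ (M_pos m k), Nat.mod_eq_of_lt ha]
  · rcases lt_or_gt_of_ne h with h | h
    · exact digit_eq_zero_of_dvd m (Dvd.intro_left _ rfl : M m j ∣ a * M m j) h
    · refine digit_eq_zero_of_lt m (lt_of_lt_of_le ?_ (M_mono m (Nat.succ_le_of_lt h)))
      exact Nat.mul_lt_mul_of_pos_right ha (M_pos m j)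

lemma mod_M_eq_of_digit_eq (m : ℕ → ℕ) [Generator m] {i j K : ℕ}
    (h : ∀ k < K, digit m i k = digit m j k) : i % M m K = j % M m K := by
  induction K with
  | zero => simp [M, Nat.mod_one]
  | succ K ih =>
    rw [M, mul_comm, Nat.mod_mul, Nat.mod_mul, ih fun k hk => h k (by omega)]
    have := h K (by omega)
    simp only [digit] at this
    rw [this]

lemma exists_digit_ne (m : ℕ → ℕ) [Generator m] {i j K : ℕ} (hi : i < M m K) (hj : j < M m K)
    (hij : i ≠ j) : ∃ k < K, digit m i k ≠ digit m j k := by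
  by_contra! h
  have := mod_M_eq_of_digit_eq m h
  rw [Nat.mod_eq_of_lt hi, Nat.mod_eq_of_lt hj] at this
  exact hij this

lemma exists_digit_ne_zero (m : ℕ → ℕ) [Generator m] {n : ℕ} (hn : n ≠ 0) :
    {j | digit m n j ≠ 0}.Nonempty := by
  obtain ⟨k, _, hk⟩ := exists_digit_ne m (lt_M m n) (M_pos m n) hn
  refine ⟨k, ?_⟩
  rwa [digit_eq_zero_of_lt m (M_pos m k)] at hk

lemma digit_lo_ne_zero (m : ℕ → ℕ) [Generator m] {n : ℕ} (hn : n ≠ 0) : digit m n (lo m n) ≠ 0 :=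
  Nat.sInf_mem (exists_digit_ne_zero m hn)

lemma digit_hi_ne_zero (m : ℕ → ℕ) [Generator m] {n : ℕ} (hn : n ≠ 0) : digit m n (hi m n) ≠ 0 :=
  Nat.sSup_mem (exists_digit_ne_zero m hn) (bddAbove_digit_ne_zero m n)

lemma lo_le_hi (m : ℕ → ℕ) [Generator m] {n : ℕ} (hn : n ≠ 0) : lo m n ≤ hi m n :=
  Nat.sInf_le (digit_hi_ne_zero m hn)

lemma M_lo_dvd (m : ℕ → ℕ) [Generator m] (n : ℕ) : M m (lo m n) ∣ n := by
  have := mod_M_eq_of_digit_eq m (i := n) (j := 0) (K := lo m n) fun k hk => by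
    rw [digit_eq_zero_of_lt m (M_pos m k)]
    simpa using Nat.notMem_of_lt_sInf hk
  rwa [Nat.zero_mod, ← Nat.dvd_iff_mod_eq_zero] at this

lemma M_hi_le (m : ℕ → ℕ) [Generator m] {n : ℕ} (hn : n ≠ 0) : M m (hi m n) ≤ n := by
  by_contra! h
  exact digit_hi_ne_zero m hn (digit_eq_zero_of_lt m h)

lemma lt_M_hi_succ (m : ℕ → ℕ) [Generator m] (n : ℕ) : n < M m (hi m n + 1) := by
  have key : n % M m (hi m n + 1) = n % M m (n + hi m n + 1) := by
    -- Digits beyond `hi m n` vanish, so enlarging the modulus does not change the remainder, which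
    -- is finally `n` itself.
    have h : ∀ t, n % M m (hi m n + 1) = n % M m (hi m n + 1 + t) := by
      intro t
      induction t with
      | zero => rfl
      | succ t ih =>
        rw [ih, ← add_assoc, M, mul_comm, Nat.mod_mul]
        have : digit m n (hi m n + 1 + t) = 0 := by
          by_contra hne
          have := le_csSup (bddAbove_digit_ne_zero m n) hne
          change _ ≤ hi m n at this
          omega
        rw [digit] at this
        rw [this]; simp
    rw [h n]; congr 2; omega
  have h2 : n < M m (n + hi m n + 1) := (lt_M m n).trans_le (M_mono m (by omega))
  rw [Nat.mod_eq_of_lt h2] at key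
  have h3 := Nat.mod_lt n (M_pos m (hi m n + 1))
  rwa [key] at h3

lemma hi_eq (m : ℕ → ℕ) [Generator m] {n k : ℕ} (h1 : M m k ≤ n) (h2 : n < M m (k + 1)) :
    hi m n = k := by
  have hn : n ≠ 0 := (lt_of_lt_of_le (M_pos m k) h1).ne'
  apply le_antisymm
  · by_contra! h
    exact absurd (M_hi_le m hn) (not_le.2 (h2.trans_le (M_mono m h)))
  · by_contra! h
    exact absurd (lt_M_hi_succ m n) (not_lt.2 ((M_mono m h).trans h1))

end Digits

/-! ### Vilenkin functions as characters -/

section Characters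

lemma psi_eq_prod (m : ℕ → ℕ) [Generator m] {n K : ℕ} (h : n < M m K) (x : G m) :
    psi m n x = ∏ k ∈ Finset.range K, rademacher m k x ^ digit m n k := by
  have key : ∀ A B, (∀ k, A ≤ k → digit m n k = 0) → A ≤ B →
      ∏ k ∈ Finset.range A, rademacher m k x ^ digit m n k =
      ∏ k ∈ Finset.range B, rademacher m k x ^ digit m n k := by
    intro A B hA hAB
    refine Finset.prod_subset (by simpa using hAB) fun k _ hk => ?_
    rw [hA k (by simpa using hk), pow_zero]
  rw [psi]
  have hK : ∀ k, K ≤ k → digit m n k = 0 := fun k hk =>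
    digit_eq_zero_of_lt m (h.trans_le (M_mono m hk))
  rcases le_total n K with hnK | hnK
  · exact key _ _ (fun k hk => digit_eq_zero m hk) hnK
  · exact (key _ _ hK hnK).symm

lemma psi_mul_M_add (m : ℕ → ℕ) [Generator m] (a : ℕ) {j r : ℕ} (hr : r < M m j) (x : G m) :
    psi m (a * M m j + r) x = psi m (a * M m j) x * psi m r x := by
  have hK := lt_M m (a * M m j + r)
  rw [psi_eq_prod m hK, psi_eq_prod m (lt_of_le_of_lt (Nat.le_add_right _ _) hK),
    psi_eq_prod m (lt_of_le_of_lt (Nat.le_add_left _ _) hK), ← Finset.prod_mul_distrib]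
  refine Finset.prod_congr rfl fun k _ => ?_
  rw [digit_mul_M_add m a hr, pow_add]

lemma psi_mul_M (m : ℕ → ℕ) [Generator m] {a j : ℕ} (ha : a < m j) (x : G m) :
    psi m (a * M m j) x = rademacher m j x ^ a := by
  have h : a * M m j < M m (j + 1) := Nat.mul_lt_mul_of_pos_right ha (M_pos m j)
  rw [psi_eq_prod m h, Finset.prod_eq_single j]
  · rw [digit_mul_M m ha, if_pos rfl]
  · intro k _ hk
    rw [digit_mul_M m ha, if_neg hk, pow_zero]
  · simp

lemma psi_zero (m : ℕ → ℕ) (x : G m) : psi m 0 x = 1 := by simp [psi]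

/-- The primitive `m_k`-th root of unity whose powers are the values of `rademacher m k`. -/
noncomputable def zeta (m : ℕ → ℕ) (k : ℕ) : ℂ := Complex.exp (2 * Real.pi * Complex.I / (m k : ℂ))

lemma zeta_primitive (m : ℕ → ℕ) [Generator m] (k : ℕ) : IsPrimitiveRoot (zeta m k) (m k) :=
  Complex.isPrimitiveRoot_exp _ (by have := Generator.two_le (m := m) k; omega)

lemma rademacher_eq (m : ℕ → ℕ) (k : ℕ) (x : G m) : rademacher m k x = zeta m k ^ (x k : ℕ) := by
  rw [zeta, ← Complex.exp_nat_mul, rademacher]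
  congr 1; ring

lemma norm_zeta (m : ℕ → ℕ) [Generator m] (k : ℕ) : ‖zeta m k‖ = 1 :=
  (zeta_primitive m k).norm'_eq_one (by have := Generator.two_le (m := m) k; omega)

lemma norm_rademacher (m : ℕ → ℕ) [Generator m] (k : ℕ) (x : G m) : ‖rademacher m k x‖ = 1 := by
  rw [rademacher_eq, norm_pow, norm_zeta, one_pow]

lemma norm_psi (m : ℕ → ℕ) [Generator m] (n : ℕ) (x : G m) : ‖psi m n x‖ = 1 := by
  simp [psi, norm_prod, norm_rademacher]

lemma rademacher_pow (m : ℕ → ℕ) [Generator m] (k : ℕ) (x : G m) :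
    rademacher m k x ^ m k = 1 := by
  rw [rademacher_eq, ← pow_mul, mul_comm, pow_mul, (zeta_primitive m k).pow_eq_one, one_pow]

lemma mul_conj_eq_one_iff {z w : ℂ} (hw : ‖w‖ = 1) : z * conj w = 1 ↔ z = w := by
  have h : w * conj w = 1 := by rw [Complex.mul_conj, Complex.normSq_eq_norm_sq, hw]; simp
  have hne : conj w ≠ 0 := right_ne_zero_of_mul (h ▸ one_ne_zero)
  rw [← h]
  exact mul_left_inj' hne

lemma rademacher_inj (m : ℕ → ℕ) [Generator m] {k : ℕ} {x y : G m} :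
    rademacher m k x = rademacher m k y ↔ x k = y k := by
  rw [rademacher_eq, rademacher_eq]
  refine ⟨fun h => Fin.ext ((zeta_primitive m k).pow_inj (x k).2 (y k).2 h), fun h => by rw [h]⟩

/-- Orthogonality of the characters of `Z_{m_k}`; it produces the passage from `I_k` to `I_{k+1}` in
`dirichlet_M`. -/
lemma geom_sum_rademacher (m : ℕ → ℕ) [Generator m] (k : ℕ) (x y : G m) :
    ∑ a ∈ Finset.range (m k), (rademacher m k x * conj (rademacher m k y)) ^ a =
      if x k = y k then (m k : ℂ) else 0 := by
  split_ifs with h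
  · rw [(mul_conj_eq_one_iff (norm_rademacher m k y)).2 ((rademacher_inj m).2 h)]
    simp
  · have hne : rademacher m k x * conj (rademacher m k y) ≠ 1 := fun h1 =>
      h ((rademacher_inj m).1 ((mul_conj_eq_one_iff (norm_rademacher m k y)).1 h1))
    rw [geom_sum_eq hne, mul_pow, ← map_pow, rademacher_pow, rademacher_pow]
    simp

end Characters

/-! ### Dirichlet kernels -/

section Kernel

/-- The Dirichlet kernel `∑_{i<n} ψ_i(x) conj(ψ_i(y))`. -/
noncomputable def dirichlet (m : ℕ → ℕ) (n : ℕ) (x y : G m) : ℂ :=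
  ∑ i ∈ Finset.range n, psi m i x * conj (psi m i y)

/-- No carry occurs when `i < M_j` is added to `a M_j`, so `ψ_{a M_j + i} = ψ_{a M_j} ψ_i` and the
second stretch of the sum factors. -/
lemma dirichlet_mul_M_add (m : ℕ → ℕ) [Generator m] (a : ℕ) {j r : ℕ} (hr : r ≤ M m j)
    (x y : G m) : dirichlet m (a * M m j + r) x y = dirichlet m (a * M m j) x y +
      psi m (a * M m j) x * conj (psi m (a * M m j) y) * dirichlet m r x y := by
  rw [dirichlet, Finset.sum_range_add, dirichlet, dirichlet, Finset.mul_sum]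
  congr 1
  refine Finset.sum_congr rfl fun i hi => ?_
  have hi' : i < M m j := (Finset.mem_range.1 hi).trans_le hr
  rw [psi_mul_M_add m a hi', psi_mul_M_add m a hi', map_mul]
  ring

lemma dirichlet_mul_M (m : ℕ → ℕ) [Generator m] {a j : ℕ} (ha : a ≤ m j) (x y : G m) :
    dirichlet m (a * M m j) x y =
      (∑ b ∈ Finset.range a, (rademacher m j x * conj (rademacher m j y)) ^ b) *
        dirichlet m (M m j) x y := by
  induction a with
  | zero => simp [dirichlet]
  | succ a ih =>
    rw [Nat.succ_mul, dirichlet_mul_M_add m a le_rfl, ih (by omega), Finset.sum_range_succ,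
      psi_mul_M m (by omega), psi_mul_M m (by omega), map_pow, mul_pow]
    ring

open Classical in
lemma dirichlet_M (m : ℕ → ℕ) [Generator m] (j : ℕ) (x y : G m) :
    dirichlet m (M m j) x y = if y ∈ I m j x then (M m j : ℂ) else 0 := by
  induction j with
  | zero => simp [dirichlet, M, I, psi_zero]
  | succ j ih =>
    rw [M, dirichlet_mul_M m le_rfl, ih, geom_sum_rademacher]
    have : y ∈ I m (j + 1) x ↔ x j = y j ∧ y ∈ I m j x := by
      simp only [I, Set.mem_ofPred_eq]
      constructor
      · exact fun h => ⟨(h j (by omega)).symm, fun i hi => h i (by omega)⟩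
      · rintro ⟨h1, h2⟩ i hi
        rcases Nat.lt_succ_iff_lt_or_eq.1 hi with h | rfl
        · exact h2 i h
        · exact h1.symm
    simp only [this]
    by_cases h1 : x j = y j <;> by_cases h2 : y ∈ I m j x <;> simp [h1, h2]

open Classical in
lemma norm_dirichlet_mul_M_add_le (m : ℕ → ℕ) [Generator m] (a : ℕ) {b j : ℕ} (hb : b ≤ m j)
    (x y : G m) : ‖dirichlet m (a * M m (j + 1) + b * M m j) x y‖ ≤
      ‖dirichlet m (a * M m (j + 1)) x y‖ + m j * (if y ∈ I m j x then (M m j : ℝ) else 0) := by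
  have hle : b * M m j ≤ M m (j + 1) := Nat.mul_le_mul_right _ hb
  rw [dirichlet_mul_M_add m a hle]
  refine (norm_add_le _ _).trans (add_le_add le_rfl ?_)
  rw [norm_mul, norm_mul, RCLike.norm_conj, norm_psi, norm_psi, one_mul, one_mul,
    dirichlet_mul_M m hb, norm_mul]
  have h1 : ‖∑ c ∈ Finset.range b, (rademacher m j x * conj (rademacher m j y)) ^ c‖ ≤ m j := by
    refine (norm_sum_le _ _).trans ?_
    simp only [norm_pow, norm_mul, RCLike.norm_conj, norm_rademacher]
    simpa using hb
  have h2 : ‖dirichlet m (M m j) x y‖ = if y ∈ I m j x then (M m j : ℝ) else 0 := by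
    rw [dirichlet_M]; split_ifs <;> simp
  rw [h2]
  exact mul_le_mul_of_nonneg_right h1 (by split_ifs <;> positivity)

lemma div_M_mul_M (m : ℕ → ℕ) [Generator m] (n j : ℕ) :
    n / M m j * M m j = n / M m (j + 1) * M m (j + 1) + digit m n j * M m j := by
  rw [digit, M, mul_comm (m j), ← Nat.div_div_eq_div_mul]
  nth_rw 1 [← Nat.div_add_mod (n / M m j) (m j)]
  ring

open Classical in
-- The digits are peeled off from the lowest upwards; the digit at `j` contributes at most `m_j`
-- copies of the kernel of order `M_j`. Nothing lies below `lo m n`, and after level `K` no digit is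
-- left.
lemma norm_dirichlet_le (m : ℕ → ℕ) [Generator m] {n K : ℕ} (hn : n < M m K) (x y : G m) :
    ‖dirichlet m n x y‖ ≤
      ∑ j ∈ Finset.Ico (lo m n) K, m j * (if y ∈ I m j x then (M m j : ℝ) else 0) := by
  rcases eq_or_ne n 0 with rfl | hn0
  · simp only [dirichlet, Finset.range_zero, Finset.sum_empty, norm_zero]
    exact Finset.sum_nonneg fun j _ => mul_nonneg (by positivity) (by split_ifs <;> positivity)
  have hlo : lo m n ≤ K := by
    by_contra! h
    exact absurd (Nat.le_of_dvd (Nat.pos_of_ne_zero hn0) (M_lo_dvd m n))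
      (not_le.2 (hn.trans_le (M_mono m h.le)))
  have key : ∀ t, ‖dirichlet m n x y‖ ≤
      ‖dirichlet m (n / M m (lo m n + t) * M m (lo m n + t)) x y‖ +
      ∑ j ∈ Finset.Ico (lo m n) (lo m n + t),
        m j * (if y ∈ I m j x then (M m j : ℝ) else 0) := by
    intro t
    induction t with
    | zero => simp [Nat.div_mul_cancel (M_lo_dvd m n)]
    | succ t ih =>
      refine ih.trans ?_
      rw [← add_assoc, Finset.sum_Ico_succ_top (by omega), div_M_mul_M m n (lo m n + t)]
      have := norm_dirichlet_mul_M_add_le m (n / M m (lo m n + t + 1)) (j := lo m n + t)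
        (b := digit m n (lo m n + t)) (Nat.mod_lt _ (by
          have := Generator.two_le (m := m) (lo m n + t); omega)).le x y
      linarith
  have := key (K - lo m n)
  rw [Nat.add_sub_cancel' hlo, Nat.div_eq_of_lt hn] at this
  simpa [dirichlet] using this

end Kernel

/-! ### Haar measure and orthonormality -/

section Measure

lemma mem_I_self (m : ℕ → ℕ) (n : ℕ) (x : G m) : x ∈ I m n x := fun _ _ => rfl

lemma mem_I_comm (m : ℕ → ℕ) {n : ℕ} {x y : G m} : y ∈ I m n x ↔ x ∈ I m n y :=
  ⟨fun h i hi => (h i hi).symm, fun h i hi => (h i hi).symm⟩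

lemma I_eq_of_mem (m : ℕ → ℕ) {n : ℕ} {x y : G m} (h : y ∈ I m n x) : I m n y = I m n x := by
  ext z
  exact ⟨fun hz i hi => (hz i hi).trans (h i hi), fun hz i hi => (hz i hi).trans (h i hi).symm⟩

lemma I_anti (m : ℕ → ℕ) {j k : ℕ} (h : j ≤ k) (x : G m) : I m k x ⊆ I m j x :=
  fun _ hy i hi => hy i (hi.trans_le h)

lemma uniformOn_univ_singleton (m : ℕ → ℕ) (k : ℕ) (a : Fin (m k)) :
    (uniformOn Set.univ : Measure (Fin (m k))) {a} = (m k : ℝ≥0∞)⁻¹ := by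
  rw [uniformOn_univ]
  simp

lemma haar_pi (m : ℕ → ℕ) [Generator m] (s : Finset ℕ) (t : (k : ℕ) → Set (Fin (m k))) :
    haar m (Set.pi s t) = ∏ k ∈ s, (uniformOn Set.univ : Measure (Fin (m k))) (t k) := by
  rw [haar, Measure.infinitePi_pi]
  exact fun i _ => MeasurableSet.of_discrete

lemma haar_I (m : ℕ → ℕ) [Generator m] (n : ℕ) (x : G m) : haar m (I m n x) = (M m n : ℝ≥0∞)⁻¹ := by
  have h : I m n x = Set.pi (Finset.range n : Set ℕ) fun k => {x k} := by
    ext y; simp [I, Set.mem_pi]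
  rw [h, haar_pi]
  simp only [uniformOn_univ_singleton]
  induction n with
  | zero => simp [M]
  | succ n ih =>
    rw [Finset.prod_range_succ, ih (by ext y; simp [I, Set.mem_pi]), M, Nat.cast_mul,
      ENNReal.mul_inv (Or.inr (ENNReal.natCast_ne_top _)) (Or.inl (ENNReal.natCast_ne_top _)),
      mul_comm]

lemma measurable_rademacher (m : ℕ → ℕ) (k : ℕ) : Measurable (rademacher m k) := by
  have : rademacher m k = (fun a : Fin (m k) =>
      Complex.exp (2 * Real.pi * Complex.I * ((a : ℕ) : ℂ) / (m k : ℂ))) ∘ fun x : G m => x k := rfl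
  rw [this]
  exact (measurable_of_finite _).comp (measurable_pi_apply k)

lemma measurable_psi (m : ℕ → ℕ) (n : ℕ) : Measurable (psi m n) := by
  unfold psi
  exact Finset.measurable_fun_prod _ fun k _ => (measurable_rademacher m k).pow_const _

lemma integrable_mul_conj_psi (m : ℕ → ℕ) [Generator m] {g : G m → ℂ} (hg : Integrable g (haar m))
    (i : ℕ) : Integrable (fun x => g x * conj (psi m i x)) (haar m) := by
  refine hg.mul_bdd (c := 1) ?_ ?_
  · exact (Complex.continuous_conj.measurable.comp (measurable_psi m i)).aestronglyMeasurable
  · exact ae_of_all _ fun x => by rw [RCLike.norm_conj, norm_psi]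

lemma integrable_psi (m : ℕ → ℕ) [Generator m] (i : ℕ) : Integrable (psi m i) (haar m) :=
  Integrable.of_bound (measurable_psi m i).aestronglyMeasurable 1
    (ae_of_all _ fun x => (norm_psi m i x).le)

lemma integral_prod_coord (m : ℕ → ℕ) [Generator m] (K : ℕ) (g : (k : ℕ) → Fin (m k) → ℂ) :
    ∫ x, ∏ k ∈ Finset.range K, g k (x k) ∂(haar m) =
      ∏ k ∈ Finset.range K, ∫ a, g k a ∂(uniformOn Set.univ : Measure (Fin (m k))) := by
  have h := integral_restrict_infinitePi
    (μ := fun k => (uniformOn Set.univ : Measure (Fin (m k)))) (s := Finset.range K)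
    (f := fun y : (i : Finset.range K) → Fin (m i) => ∏ i : Finset.range K, g i (y i))
    (measurable_of_finite _).aestronglyMeasurable
  rw [integral_fintype_prod_eq_prod (fun i : Finset.range K => g i)] at h
  rw [haar]
  simp only [← Finset.prod_coe_sort (Finset.range K)]
  exact h

lemma integral_uniformOn (m : ℕ → ℕ) [Generator m] (k : ℕ) (g : Fin (m k) → ℂ) :
    ∫ a, g a ∂(uniformOn Set.univ : Measure (Fin (m k))) = (m k : ℂ)⁻¹ * ∑ a, g a := by
  rw [integral_fintype Integrable.of_finite, Finset.mul_sum]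
  refine Finset.sum_congr rfl fun a _ => ?_
  rw [Measure.real, uniformOn_univ_singleton]
  simp

/-- If `i ≠ j`, some digit differs; the integral is a product over coordinates, and the factor at
that digit is a full sum of powers of a nontrivial root of unity. -/
lemma integral_psi_mul_conj (m : ℕ → ℕ) [Generator m] (i j : ℕ) :
    ∫ x, psi m i x * conj (psi m j x) ∂(haar m) = if i = j then 1 else 0 := by
  split_ifs with h
  · subst h
    simp only [Complex.mul_conj, Complex.normSq_eq_norm_sq, norm_psi]
    simp
  · have hi : i < M m (i + j) := (lt_M m i).trans_le (M_mono m (by omega))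
    have hj : j < M m (i + j) := (lt_M m j).trans_le (M_mono m (by omega))
    obtain ⟨k, hk, hne⟩ := exists_digit_ne m hi hj h
    have e : ∀ x : G m, psi m i x * conj (psi m j x) = ∏ k ∈ Finset.range (i + j),
        (fun (k : ℕ) (a : Fin (m k)) => (zeta m k ^ (a : ℕ)) ^ digit m i k *
          conj ((zeta m k ^ (a : ℕ)) ^ digit m j k)) k (x k) := by
      intro x
      rw [psi_eq_prod m hi, psi_eq_prod m hj, map_prod, ← Finset.prod_mul_distrib]
      simp only [rademacher_eq]
    simp only [e]
    rw [integral_prod_coord m _ (fun (k : ℕ) (a : Fin (m k)) => (zeta m k ^ (a : ℕ)) ^ digit m i k *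
          conj ((zeta m k ^ (a : ℕ)) ^ digit m j k))]
    refine Finset.prod_eq_zero (Finset.mem_range.2 hk) ?_
    rw [integral_uniformOn, Fin.sum_univ_eq_sum_range (fun a => (zeta m k ^ a) ^ digit m i k *
          conj ((zeta m k ^ a) ^ digit m j k))]
    have e2 : ∀ a, (zeta m k ^ a) ^ digit m i k * conj ((zeta m k ^ a) ^ digit m j k) =
        (zeta m k ^ digit m i k * conj (zeta m k ^ digit m j k)) ^ a := by
      intro a; rw [mul_pow, ← map_pow]; ring_nf
    have hm : 0 < m k := by have := Generator.two_le (m := m) k; omega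
    have hz : zeta m k ^ digit m i k * conj (zeta m k ^ digit m j k) ≠ 1 := by
      rw [Ne, mul_conj_eq_one_iff (by rw [norm_pow, norm_zeta, one_pow])]
      exact fun h1 => hne ((zeta_primitive m k).pow_inj (Nat.mod_lt _ hm) (Nat.mod_lt _ hm) h1)
    simp only [e2]
    rw [geom_sum_eq hz, mul_pow, ← map_pow, ← pow_mul, ← pow_mul, mul_comm _ (m k),
      mul_comm _ (m k), pow_mul, pow_mul, (zeta_primitive m k).pow_eq_one]
    simp

end Measure

/-! ### Partial sums of Vilenkin series -/

section PartialSums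

/-- The partial sum `∑_{i<n} a_i ψ_i` of the Vilenkin series with coefficients `a`. -/
noncomputable def psum (m : ℕ → ℕ) (a : ℕ → ℂ) (n : ℕ) (x : G m) : ℂ :=
  ∑ i ∈ Finset.range n, a i * psi m i x

lemma measurable_psum (m : ℕ → ℕ) (a : ℕ → ℂ) (n : ℕ) : Measurable (psum m a n) := by
  unfold psum
  exact Finset.measurable_fun_sum _ fun k _ => (measurable_psi m k).const_mul _

lemma integrable_psum (m : ℕ → ℕ) [Generator m] (a : ℕ → ℂ) (n : ℕ) :
    Integrable (psum m a n) (haar m) := by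
  unfold psum
  exact integrable_finsetSum _ fun k _ => (integrable_psi m k).const_mul _

lemma coeff_psum (m : ℕ → ℕ) [Generator m] (a : ℕ → ℂ) (n j : ℕ) :
    coeff m (psum m a n) j = if j < n then a j else 0 := by
  unfold coeff psum
  simp only [Finset.sum_mul, mul_assoc]
  rw [integral_finsetSum]
  · simp only [integral_const_mul, integral_psi_mul_conj]
    simp
  · exact fun i _ => (integrable_mul_conj_psi m (integrable_psi m i) j).const_mul _

lemma SFun_psum (m : ℕ → ℕ) [Generator m] (a : ℕ → ℂ) (n N : ℕ) :
    SFun m N (psum m a n) = psum m a (min n N) := by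
  ext x
  simp only [SFun, coeff_psum, psum, ite_mul, zero_mul]
  rw [← Finset.sum_filter]
  congr 1
  ext i; simp [and_comm]

lemma psi_congr (m : ℕ → ℕ) [Generator m] {l i : ℕ} (hi : i < M m l) {x y : G m}
    (h : y ∈ I m l x) : psi m i y = psi m i x := by
  rw [psi_eq_prod m hi, psi_eq_prod m hi]
  refine Finset.prod_congr rfl fun k hk => ?_
  rw [rademacher_eq, rademacher_eq, h k (Finset.mem_range.1 hk)]

lemma psum_congr (m : ℕ → ℕ) [Generator m] (a : ℕ → ℂ) {l n : ℕ} (hn : n ≤ M m l) {x y : G m}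
    (h : y ∈ I m l x) : psum m a n y = psum m a n x :=
  Finset.sum_congr rfl fun i hi => by
    rw [psi_congr m ((Finset.mem_range.1 hi).trans_le hn) h]

lemma SFun_eq_integral (m : ℕ → ℕ) [Generator m] {g : G m → ℂ} (hg : Integrable g (haar m))
    (n : ℕ) (x : G m) : SFun m n g x = ∫ y, g y * dirichlet m n x y ∂(haar m) := by
  simp only [SFun, coeff, dirichlet, Finset.mul_sum]
  rw [integral_finsetSum]
  · refine Finset.sum_congr rfl fun i _ => ?_
    rw [← integral_mul_const]
    congr 1; ext y; ring
  · intro i _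
    refine ((integrable_mul_conj_psi m hg i).mul_const (psi m i x)).congr ?_
    exact ae_of_all _ fun y => by ring

/-- Partial sums of order `M_l` are averages over `I_l(x)`, hence conditional expectations. This
links Fourier series with martingales. -/
lemma SFun_M (m : ℕ → ℕ) [Generator m] {g : G m → ℂ} (hg : Integrable g (haar m)) (l : ℕ)
    (x : G m) : SFun m (M m l) g x = M m l * ∫ y in I m l x, g y ∂(haar m) := by
  classical
  rw [SFun_eq_integral m hg, ← integral_indicator (measurableSet_I m l x), ← integral_const_mul]
  congr 1; ext y
  rw [dirichlet_M, Set.indicator_apply]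
  split_ifs <;> ring

lemma SFun_M_of_congr (m : ℕ → ℕ) [Generator m] {g : G m → ℂ} {l : ℕ}
    (hc : ∀ x, ∀ y ∈ I m l x, g y = g x) (hg : Integrable g (haar m)) :
    SFun m (M m l) g = g := by
  ext x
  rw [SFun_M m hg, setIntegral_congr_fun (measurableSet_I m l x) (hc x), setIntegral_const,
    Measure.real, haar_I]
  have : (M m l : ℂ) ≠ 0 := by exact_mod_cast (M_pos m l).ne'
  simp [this]

end PartialSums

/-! ### Martingales as Vilenkin series -/

section Martingales

/-- There are only finitely many intervals of order `l` and they partition the group, so measurable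
means a union of them. -/
lemma sigmaI_iff (m : ℕ → ℕ) [Generator m] (l : ℕ) {s : Set (G m)} :
    MeasurableSet[sigmaI m l] s ↔ ∀ x y, y ∈ I m l x → (y ∈ s ↔ x ∈ s) := by
  constructor
  · intro hs
    induction s, hs using MeasurableSpace.generateFrom_induction with
    | hC t ht _ =>
      obtain ⟨z, rfl⟩ := ht
      intro x y hxy
      rw [mem_I_comm m, mem_I_comm m (x := z), I_eq_of_mem m hxy]
    | empty => simp
    | compl t _ ih => exact fun x y h => not_congr (ih x y h)
    | iUnion t _ ih =>
      intro x y h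
      simp only [Set.mem_iUnion]
      exact exists_congr fun n => ih n x y h
  · intro h
    let C : Set (Set (G m)) := {t | ∃ x ∈ s, t = I m l x}
    have hs : s = ⋃₀ C := by
      ext y
      refine ⟨fun hy => ⟨_, ⟨y, hy, rfl⟩, mem_I_self m l y⟩, ?_⟩
      rintro ⟨_, ⟨x, hx, rfl⟩, hy⟩
      exact (h x y hy).2 hx
    have hfin : C.Finite := by
      refine (Set.finite_range fun u : (i : Fin l) → Fin (m i) =>
        {z : G m | ∀ i : Fin l, z i = u i}).subset ?_
      rintro _ ⟨y, _, rfl⟩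
      refine ⟨fun i => y i, ?_⟩
      ext z
      exact ⟨fun h i hi => h ⟨i, hi⟩, fun h i => h i i.2⟩
    rw [hs]
    refine @MeasurableSet.sUnion _ (sigmaI m l) _ hfin.countable ?_
    rintro _ ⟨y, _, rfl⟩
    exact MeasurableSpace.measurableSet_generateFrom ⟨y, rfl⟩

lemma measurable_sigmaI_iff (m : ℕ → ℕ) [Generator m] (l : ℕ) {g : G m → ℂ} :
    Measurable[sigmaI m l] g ↔ ∀ x, ∀ y ∈ I m l x, g y = g x := by
  constructor
  · intro hg x y hy
    have := (sigmaI_iff m l).1 (hg (measurableSet_singleton (g x))) x y hy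
    simpa using this
  · intro h s _
    rw [sigmaI_iff]
    intro x y hy
    rw [Set.mem_preimage, Set.mem_preimage, h x y hy]

lemma integral_psum_I (m : ℕ → ℕ) [Generator m] (a : ℕ → ℂ) {l n : ℕ} (h : M m l ≤ n) (x : G m) :
    ∫ y in I m l x, psum m a n y ∂(haar m) = ∫ y in I m l x, psum m a (M m l) y ∂(haar m) := by
  have hM : (M m l : ℂ) ≠ 0 := by exact_mod_cast (M_pos m l).ne'
  refine mul_left_cancel₀ hM ?_
  rw [← SFun_M m (integrable_psum m a _), ← SFun_M m (integrable_psum m a _), SFun_psum, SFun_psum,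
    min_eq_right h, min_self]

lemma isPiSystem_I (m : ℕ → ℕ) (l : ℕ) : IsPiSystem {s | ∃ x, s = I m l x} := by
  rintro _ ⟨x, rfl⟩ _ ⟨y, rfl⟩ ⟨z, hx, hy⟩
  refine ⟨z, ?_⟩
  rw [← I_eq_of_mem m hx, ← I_eq_of_mem m hy, Set.inter_self]

lemma setIntegral_psum (m : ℕ → ℕ) [Generator m] (a : ℕ → ℂ) {l n : ℕ} (h : M m l ≤ n)
    {s : Set (G m)} (hs : MeasurableSet[sigmaI m l] s) :
    ∫ y in s, psum m a (M m l) y ∂(haar m) = ∫ y in s, psum m a n y ∂(haar m) := by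
  have hle := (filtration m).le l
  have hi := fun n => integrable_psum m a n
  -- The total integral is the coefficient of index `0`; it is needed for complements in the π-λ
  -- induction.
  have h0 : ∫ y, psum m a (M m l) y ∂(haar m) = ∫ y, psum m a n y ∂(haar m) := by
    have e : ∀ k, ∫ y, psum m a k y ∂(haar m) = coeff m (psum m a k) 0 := fun k => by
      simp [coeff, psi_zero]
    rw [e, e, coeff_psum, coeff_psum, if_pos (M_pos m l), if_pos ((M_pos m l).trans_le h)]
  induction s, hs using MeasurableSpace.induction_on_inter (m := sigmaI m l) rfl
    (isPiSystem_I m l) with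
  | empty => simp
  | basic t ht =>
    obtain ⟨x, rfl⟩ := ht
    exact (integral_psum_I m a h x).symm
  | compl t ht ih =>
    rw [setIntegral_compl (hle t ht) (hi _), setIntegral_compl (hle t ht) (hi _), ih, h0]
  | iUnion t hd ht ih =>
    rw [integral_iUnion (fun i => hle _ (ht i)) hd (hi _).integrableOn,
      integral_iUnion (fun i => hle _ (ht i)) hd (hi _).integrableOn]
    exact tsum_congr ih

lemma martingale_psum (m : ℕ → ℕ) [Generator m] (a : ℕ → ℂ) :
    Martingale (fun l => psum m a (M m l)) (filtration m) (haar m) := by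
  refine martingale_of_setIntegral_eq_succ ?_ (fun l => integrable_psum m a _) fun l s hs => ?_
  · intro l
    exact ((measurable_sigmaI_iff m l).2 fun x y hy =>
      psum_congr m a le_rfl hy).stronglyMeasurable
  · exact setIntegral_psum m a (M_mono m (Nat.le_succ l)) hs

lemma martCoeff_psum (m : ℕ → ℕ) [Generator m] (a : ℕ → ℂ) :
    martCoeff m (fun l => psum m a (M m l)) = a := by
  ext i
  refine Tendsto.limUnder_eq (tendsto_const_nhds.congr' ?_)
  filter_upwards [eventually_ge_atTop i] with l hl
  rw [coeff_psum, if_pos ((lt_M m i).trans_le (M_mono m hl))]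

/-- A martingale consists of the partial sums of order `M_l` of its Vilenkin-Fourier series. -/
lemma eq_psum_of_martingale (m : ℕ → ℕ) [Generator m] {f : ℕ → G m → ℂ}
    (hf : Martingale f (filtration m) (haar m)) :
    f = fun l => psum m (martCoeff m f) (M m l) := by
  have hint := fun l => hf.integrable l
  -- Constancy on intervals makes `f l` its own average, and the martingale property replaces it by
  -- the average of a later `f l'`.
  have hc : ∀ l x, ∀ y ∈ I m l x, f l y = f l x := fun l =>
    (measurable_sigmaI_iff m l).1 (hf.1 l).measurable
  have hrep : ∀ l l', l ≤ l' → f l = psum m (coeff m (f l')) (M m l) := by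
    intro l l' h
    ext x
    rw [← SFun_M_of_congr m (hc l) (hint l), SFun_M m (hint l), hf.setIntegral_eq h
      (MeasurableSpace.measurableSet_generateFrom ⟨x, rfl⟩), ← SFun_M m (hint l')]
    rfl
  have hcoeff : ∀ l l' i, l ≤ l' → i < M m l → coeff m (f l) i = coeff m (f l') i := by
    intro l l' i h hi
    rw [hrep l l' h, coeff_psum, if_pos hi]
  have hmart : ∀ l i, i < M m l → martCoeff m f i = coeff m (f l) i := by
    intro l i hi
    refine Tendsto.limUnder_eq (tendsto_const_nhds.congr' ?_)
    filter_upwards [eventually_ge_atTop l] with l' hl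
    exact hcoeff l l' i hl hi
  ext l x
  conv_lhs => rw [hrep l l le_rfl]
  exact Finset.sum_congr rfl fun i hi => by rw [hmart l i (Finset.mem_range.1 hi)]

lemma toMart_psum (m : ℕ → ℕ) [Generator m] (a : ℕ → ℂ) (n : ℕ) :
    toMart m (psum m a n) = fun l => psum m a (min n (M m l)) := by
  ext l x
  rw [toMart, SFun_psum]

end Martingales

/-! ### Integrals over intervals -/

section LocalIntegrals

lemma measurableSet_I_prod (m : ℕ → ℕ) (j : ℕ) :
    MeasurableSet {q : G m × G m | q.2 ∈ I m j q.1} := by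
  have : {q : G m × G m | q.2 ∈ I m j q.1} =
      ⋂ i, ⋂ (_ : i < j), {q : G m × G m | q.2 i = q.1 i} := by
    ext q; simp [I]
  rw [this]
  refine MeasurableSet.iInter fun i => MeasurableSet.iInter fun _ => ?_
  exact measurableSet_eq_fun ((measurable_pi_apply i).comp measurable_snd)
    ((measurable_pi_apply i).comp measurable_fst)

lemma measurable_indicator_I_prod (m : ℕ → ℕ) (j : ℕ) {u : G m → ℝ≥0∞} (hu : Measurable u) :
    Measurable fun q : G m × G m => (I m j q.1).indicator u q.2 :=
  (hu.comp measurable_snd).indicator (measurableSet_I_prod m j)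

lemma measurable_setLIntegral_I (m : ℕ → ℕ) [Generator m] (j : ℕ) {u : G m → ℝ≥0∞}
    (hu : Measurable u) : Measurable fun x => ∫⁻ y in I m j x, u y ∂(haar m) := by
  simp only [← lintegral_indicator (measurableSet_I m j _)]
  exact (measurable_indicator_I_prod m j hu).lintegral_prod_right'

/-- Tonelli together with the symmetry of `y ∈ I_j(x)`: each `y` is counted on a set of measure
`1/M_j`. -/
lemma lintegral_setLIntegral_I (m : ℕ → ℕ) [Generator m] (j : ℕ) {u : G m → ℝ≥0∞}
    (hu : Measurable u) : ∫⁻ x, ∫⁻ y in I m j x, u y ∂(haar m) ∂(haar m) =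
      (M m j : ℝ≥0∞)⁻¹ * ∫⁻ y, u y ∂(haar m) := by
  simp only [← lintegral_indicator (measurableSet_I m j _)]
  rw [lintegral_lintegral_swap (measurable_indicator_I_prod m j hu).aemeasurable,
    ← lintegral_const_mul _ hu]
  refine lintegral_congr fun y => ?_
  have : ∀ x, (I m j x).indicator u y = (I m j y).indicator (fun _ => u y) x := by
    intro x
    classical
    simp only [Set.indicator_apply, mem_I_comm m (x := x)]
  simp only [this]
  rw [lintegral_indicator (measurableSet_I m j y), setLIntegral_const, haar_I, mul_comm]

/-- A reverse Hölder inequality for functions that are constant on the intervals of order `K`. -/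
lemma setLIntegral_rpow_le (m : ℕ → ℕ) [Generator m] {p : ℝ} (hp1 : p < 1)
    {j K : ℕ} (hjK : j ≤ K) {u : G m → ℝ≥0∞} (hu : Measurable u) (hfin : ∫⁻ y, u y ∂(haar m) ≠ ∞)
    (hc : ∀ x, ∀ y ∈ I m K x, u y = u x) (hp0 : 0 < p) (x : G m) :
    (∫⁻ y in I m j x, u y ∂(haar m)) ^ p ≤
      (M m K : ℝ≥0∞) ^ (1 - p) * ∫⁻ y in I m j x, u y ^ p ∂(haar m) := by
  set J := ∫⁻ y in I m j x, u y ∂(haar m) with hJ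
  have hJfin : J ≠ ∞ := ne_top_of_le_ne_top hfin (setLIntegral_le_lintegral _ _)
  rcases eq_or_ne J 0 with h0 | h0
  · rw [h0, ENNReal.zero_rpow_of_pos hp0]; exact zero_le
  have hMK : (M m K : ℝ≥0∞) ≠ 0 := by exact_mod_cast (M_pos m K).ne'
  -- The integral over `I_K(y)` alone already equals `u y / M_K`. Writing `u = u^(1-p) u^p` and
  -- using this bound on the first factor, the claim follows on dividing by `J^(1-p)`.
  have hbound : ∀ y ∈ I m j x, u y ≤ M m K * J := by
    intro y hy
    have h1 : ∫⁻ z in I m K y, u z ∂(haar m) = u y * (M m K : ℝ≥0∞)⁻¹ := by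
      rw [setLIntegral_congr_fun (measurableSet_I m K y) (hc y), setLIntegral_const, haar_I]
    have h2 : I m K y ⊆ I m j x := by
      rw [← I_eq_of_mem m hy]; exact I_anti m hjK y
    have h3 : u y * (M m K : ℝ≥0∞)⁻¹ ≤ J := h1 ▸ lintegral_mono_set h2
    rwa [← div_eq_mul_inv, ENNReal.div_le_iff' hMK (ENNReal.natCast_ne_top _)] at h3
  have hle : J ≤ (M m K * J) ^ (1 - p) * ∫⁻ y in I m j x, u y ^ p ∂(haar m) := by
    rw [← lintegral_const_mul _ (hu.pow_const p), hJ]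
    refine setLIntegral_mono ((hu.pow_const p).const_mul _) fun y hy => ?_
    calc u y = u y ^ (1 - p) * u y ^ p := by
          rw [← ENNReal.rpow_add_of_nonneg _ _ (by linarith) hp0.le]; simp
      _ ≤ _ := mul_le_mul' (ENNReal.rpow_le_rpow (hbound y hy) (by linarith)) le_rfl
  rw [ENNReal.mul_rpow_of_nonneg _ _ (by linarith : 0 ≤ 1 - p)] at hle
  have h4 : J ^ p = J * J ^ (-(1 - p)) := by
    nth_rw 2 [← ENNReal.rpow_one J]
    rw [← ENNReal.rpow_add _ _ h0 hJfin]; congr 1; ring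
  have h5 : J ^ (1 - p) * J ^ (-(1 - p)) = 1 := by
    rw [← ENNReal.rpow_add _ _ h0 hJfin]; simp
  rw [h4]
  calc J * J ^ (-(1 - p)) ≤ _ := mul_le_mul_left hle _
    _ = ((M m K : ℝ≥0∞) ^ (1 - p) * ∫⁻ y in I m j x, u y ^ p ∂(haar m)) *
        (J ^ (1 - p) * J ^ (-(1 - p))) := by ring
    _ = _ := by rw [h5, mul_one]

lemma enorm_psum_le (m : ℕ → ℕ) [Generator m] {L : ℕ} (hL : ∀ j, m j ≤ L) (b : ℕ → ℂ)
    {n K : ℕ} (hn : n ≤ M m K) (x : G m) :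
    ‖psum m b n x‖ₑ ≤ ∑ j ∈ Finset.Ico (lo m n) (K + 1),
      (L : ℝ≥0∞) * (M m j * ∫⁻ y in I m j x, ‖psum m b (M m K) y‖ₑ ∂(haar m)) := by
  classical
  set h := psum m b (M m K)
  have hm : Measurable fun y => ‖h y‖ₑ := (measurable_psum m b _).enorm
  have e : psum m b n x = ∫ y, h y * dirichlet m n x y ∂(haar m) := by
    rw [← SFun_eq_integral m (integrable_psum m b _), SFun_psum, min_eq_right hn]
  -- The case `n = M_K` is allowed, which is why the sum over levels includes `K`.
  have hlt : n < M m (K + 1) := lt_of_le_of_lt hn (by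
    have h1 := M_pos m K
    have h2 : 2 ≤ m K := Generator.two_le K
    rw [M]; nlinarith)
  have hD : ∀ y, ‖dirichlet m n x y‖ₑ ≤ ∑ j ∈ Finset.Ico (lo m n) (K + 1),
      (L : ℝ≥0∞) * (I m j x).indicator (fun _ => (M m j : ℝ≥0∞)) y := by
    intro y
    rw [← ofReal_norm]
    refine (ENNReal.ofReal_le_ofReal (norm_dirichlet_le m hlt x y)).trans ?_
    rw [ENNReal.ofReal_sum_of_nonneg (fun j _ => mul_nonneg (by positivity)
      (by split_ifs <;> positivity))]
    refine Finset.sum_le_sum fun j _ => ?_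
    rw [ENNReal.ofReal_mul (by positivity), ENNReal.ofReal_natCast]
    refine mul_le_mul' (by exact_mod_cast hL j) ?_
    rw [Set.indicator_apply]
    split_ifs <;> simp
  rw [e]
  refine (enorm_integral_le_lintegral_enorm _).trans ?_
  calc ∫⁻ y, ‖h y * dirichlet m n x y‖ₑ ∂(haar m)
      ≤ ∫⁻ y, ∑ j ∈ Finset.Ico (lo m n) (K + 1),
        (L : ℝ≥0∞) * (M m j * (I m j x).indicator (fun y => ‖h y‖ₑ) y) ∂(haar m) := by
        refine lintegral_mono fun y => ?_
        rw [enorm_mul]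
        refine (mul_le_mul_right (hD y) _).trans_eq ?_
        rw [Finset.mul_sum]
        refine Finset.sum_congr rfl fun j _ => ?_
        simp only [Set.indicator_apply]
        split_ifs <;> ring
    _ = _ := by
        rw [lintegral_finsetSum _ (fun j _ => (((hm.indicator (measurableSet_I m j x)).const_mul
          _).const_mul _))]
        refine Finset.sum_congr rfl fun j _ => ?_
        rw [lintegral_const_mul _ ((hm.indicator (measurableSet_I m j x)).const_mul _),
          lintegral_const_mul _ (hm.indicator (measurableSet_I m j x)),
          lintegral_indicator (measurableSet_I m j x)]

end LocalIntegrals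

/-! ### The `L_p` bound for partial sums -/

section PartialSumBound

lemma rpow_sum_le {ι : Type*} (s : Finset ι) (u : ι → ℝ≥0∞) {p : ℝ} (hp0 : 0 < p) (hp1 : p ≤ 1) :
    (∑ i ∈ s, u i) ^ p ≤ ∑ i ∈ s, u i ^ p := by
  classical
  induction s using Finset.induction_on with
  | empty => simp [hp0]
  | insert i s hi ih =>
    rw [Finset.sum_insert hi, Finset.sum_insert hi]
    exact (ENNReal.rpow_add_le_add_rpow _ _ hp0.le hp1).trans (add_le_add le_rfl ih)

lemma rpow_div_M_add_le (m : ℕ → ℕ) [Generator m] {q : ℝ} (hq : 0 ≤ q) (A : ℝ≥0∞) (s t : ℕ) :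
    (A / M m (s + t)) ^ q ≤ (A / M m s) ^ q * ((2 : ℝ≥0∞)⁻¹ ^ q) ^ t := by
  rw [← ENNReal.rpow_natCast, ← ENNReal.rpow_mul, mul_comm q, ENNReal.rpow_mul,
    ← ENNReal.mul_rpow_of_nonneg _ _ hq]
  refine ENNReal.rpow_le_rpow ?_ hq
  rw [ENNReal.rpow_natCast, div_eq_mul_inv, div_eq_mul_inv, mul_assoc, ← ENNReal.inv_pow,
    ← ENNReal.mul_inv (Or.inr (by simp)) (Or.inl (ENNReal.natCast_ne_top _))]
  gcongr
  exact_mod_cast M_mul_two_pow_le m s t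

/-- For `p < 1` the `p`-th power is subadditive, so the levels `j` can be estimated separately: the
kernel gives `M_j^p`, reverse Hölder `M_K^(1-p)`, and integration over `x` gives `1/M_j`. The
geometric series in `(1/2)^(1-p)` sums the levels. -/
lemma lintegral_enorm_psum_rpow_le (m : ℕ → ℕ) [Generator m] {p : ℝ} (hp0 : 0 < p) (hp1 : p < 1)
    {L : ℕ} (hL : ∀ j, m j ≤ L) (b : ℕ → ℂ) {n K : ℕ} (hn : n ≤ M m K) :
    ∫⁻ x, ‖psum m b n x‖ₑ ^ p ∂(haar m) ≤
      (L : ℝ≥0∞) ^ p * (1 - (2 : ℝ≥0∞)⁻¹ ^ (1 - p))⁻¹ *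
        ((M m K : ℝ≥0∞) / M m (lo m n)) ^ (1 - p) *
          ∫⁻ x, ‖psum m b (M m K) x‖ₑ ^ p ∂(haar m) := by
  set h := psum m b (M m K)
  have hm : Measurable fun y => ‖h y‖ₑ := (measurable_psum m b _).enorm
  set U := ∫⁻ x, ‖h x‖ₑ ^ p ∂(haar m)
  set s := lo m n
  have hq : 0 < 1 - p := by linarith
  have hlevel : ∀ j ∈ Finset.Ico s (K + 1), ∫⁻ x, ((L : ℝ≥0∞) * (M m j *
      ∫⁻ y in I m j x, ‖h y‖ₑ ∂(haar m))) ^ p ∂(haar m) ≤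
        (L : ℝ≥0∞) ^ p * ((M m K : ℝ≥0∞) / M m j) ^ (1 - p) * U := by
    intro j hj
    have hjK : j ≤ K := by have := (Finset.mem_Ico.1 hj).2; omega
    have hM0 : (M m j : ℝ≥0∞) ≠ 0 := by exact_mod_cast (M_pos m j).ne'
    have hMt : (M m j : ℝ≥0∞) ≠ ∞ := ENNReal.natCast_ne_top _
    calc _ ≤ ∫⁻ x, ((L : ℝ≥0∞) ^ p * ((M m j : ℝ≥0∞) ^ p * (M m K : ℝ≥0∞) ^ (1 - p))) *
          ∫⁻ y in I m j x, ‖h y‖ₑ ^ p ∂(haar m) ∂(haar m) := by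
          refine lintegral_mono fun x => ?_
          rw [ENNReal.mul_rpow_of_nonneg _ _ hp0.le, ENNReal.mul_rpow_of_nonneg _ _ hp0.le,
            mul_assoc, mul_assoc]
          gcongr
          refine setLIntegral_rpow_le m hp1 hjK hm (integrable_psum m b _).2.ne ?_ hp0 x
          intro x y hy
          rw [show h y = h x from psum_congr m b le_rfl hy]
      _ = ((L : ℝ≥0∞) ^ p * ((M m j : ℝ≥0∞) ^ p * (M m K : ℝ≥0∞) ^ (1 - p))) *
          ((M m j : ℝ≥0∞)⁻¹ * U) := by
          rw [lintegral_const_mul _ (measurable_setLIntegral_I m j (hm.pow_const p)),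
            lintegral_setLIntegral_I m j (hm.pow_const p)]
      _ = _ := by
          have : (M m j : ℝ≥0∞) ^ p * (M m j : ℝ≥0∞)⁻¹ = (M m j : ℝ≥0∞)⁻¹ ^ (1 - p) := by
            rw [← ENNReal.rpow_neg_one, ← ENNReal.rpow_add _ _ hM0 hMt, ← ENNReal.rpow_mul]
            congr 1; ring
          rw [div_eq_mul_inv, ENNReal.mul_rpow_of_nonneg _ _ hq.le, ← this]
          ring
  have hgeom : ∑ j ∈ Finset.Ico s (K + 1), ((M m K : ℝ≥0∞) / M m j) ^ (1 - p) ≤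
      ((M m K : ℝ≥0∞) / M m s) ^ (1 - p) * (1 - (2 : ℝ≥0∞)⁻¹ ^ (1 - p))⁻¹ := by
    rw [Finset.sum_Ico_eq_sum_range, ← ENNReal.tsum_geometric, ← ENNReal.tsum_mul_left]
    refine (Finset.sum_le_sum fun t _ => ?_).trans (ENNReal.sum_le_tsum _)
    exact rpow_div_M_add_le m hq.le _ s t
  calc _ ≤ ∫⁻ x, ∑ j ∈ Finset.Ico s (K + 1), ((L : ℝ≥0∞) * (M m j *
        ∫⁻ y in I m j x, ‖h y‖ₑ ∂(haar m))) ^ p ∂(haar m) := by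
        refine lintegral_mono fun x => ?_
        exact (ENNReal.rpow_le_rpow (enorm_psum_le m hL b hn x) hp0.le).trans
          (rpow_sum_le _ _ hp0 hp1.le)
    _ = ∑ j ∈ Finset.Ico s (K + 1), ∫⁻ x, ((L : ℝ≥0∞) * (M m j *
        ∫⁻ y in I m j x, ‖h y‖ₑ ∂(haar m))) ^ p ∂(haar m) :=
        lintegral_finsetSum _ fun j _ =>
          (((measurable_setLIntegral_I m j hm).const_mul _).const_mul _).pow_const p
    _ ≤ ∑ j ∈ Finset.Ico s (K + 1), (L : ℝ≥0∞) ^ p * ((M m K : ℝ≥0∞) / M m j) ^ (1 - p) * U :=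
        Finset.sum_le_sum hlevel
    _ = (L : ℝ≥0∞) ^ p * (∑ j ∈ Finset.Ico s (K + 1), ((M m K : ℝ≥0∞) / M m j) ^ (1 - p)) * U := by
        rw [Finset.mul_sum, Finset.sum_mul]
    _ ≤ (L : ℝ≥0∞) ^ p * (((M m K : ℝ≥0∞) / M m s) ^ (1 - p) *
        (1 - (2 : ℝ≥0∞)⁻¹ ^ (1 - p))⁻¹) * U := by gcongr
    _ = _ := by ring

end PartialSumBound

/-! ### Approximation in `H_p` -/

section Approximation

lemma psum_sub (m : ℕ → ℕ) (a : ℕ → ℂ) {N n : ℕ} (h : N ≤ n) (x : G m) :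
    psum m a n x - psum m a N x = psum m (fun i => if N ≤ i then a i else 0) n x := by
  simp only [psum, ite_mul, zero_mul]
  rw [← Finset.sum_filter, ← Finset.sum_range_add_sum_Ico _ h, add_sub_cancel_left]
  refine Finset.sum_congr ?_ fun _ _ => rfl
  ext i; simp [and_comm]

/-- The term `min n (M m l)` is the order of `S_{M_l} S_n`; in this form the difference vanishes as
long as `M_l ≤ n`. -/
lemma errHp_eq (m : ℕ → ℕ) [Generator m] {p : ℝ} {f : ℕ → G m → ℂ}
    (hf : Martingale f (filtration m) (haar m)) (n : ℕ) : errHp m p n f =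
      hpNorm m p fun l x => psum m (martCoeff m f) (min n (M m l)) x -
        psum m (martCoeff m f) (M m l) x := by
  have : toMart m (S m n f) = fun l => psum m (martCoeff m f) (min n (M m l)) :=
    toMart_psum m (martCoeff m f) n
  rw [errHp, this]
  conv_lhs => rw [eq_psum_of_martingale m hf, martCoeff_psum]
  rfl

lemma omega_eq (m : ℕ → ℕ) [Generator m] {p : ℝ} {f : ℕ → G m → ℂ}
    (hf : Martingale f (filtration m) (haar m)) (k : ℕ) : omega m p k f =
      hpNorm m p fun l x => psum m (martCoeff m f) (M m l) x -
        psum m (martCoeff m f) (min (M m k) (M m l)) x := by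
  have : toMart m (S m (M m k) f) = fun l => psum m (martCoeff m f) (min (M m k) (M m l)) :=
    toMart_psum m (martCoeff m f) (M m k)
  rw [omega, this]
  conv_lhs => rw [eq_psum_of_martingale m hf, martCoeff_psum]
  rfl

lemma errHp_M (m : ℕ → ℕ) [Generator m] {p : ℝ} {f : ℕ → G m → ℂ}
    (hf : Martingale f (filtration m) (haar m)) (k : ℕ) :
    errHp m p (M m k) f = omega m p k f := by
  rw [errHp_eq m hf, omega_eq m hf, hpNorm, hpNorm]
  simp only [enorm_sub_rev]

lemma one_le_M_div (m : ℕ → ℕ) [Generator m] {j k : ℕ} (h : j ≤ k) :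
    1 ≤ (M m k : ℝ≥0∞) / M m j := by
  rw [ENNReal.le_div_iff_mul_le (Or.inl (by exact_mod_cast (M_pos m j).ne'))
    (Or.inl (ENNReal.natCast_ne_top _)), one_mul]
  exact_mod_cast M_mono m h

lemma one_le_ratio (m : ℕ → ℕ) [Generator m] {p : ℝ} (hp0 : 0 < p) (hp1 : p < 1) {n : ℕ}
    (hn : n ≠ 0) : 1 ≤ ratio m p n := by
  refine ENNReal.one_le_rpow (one_le_M_div m (lo_le_hi m hn)) ?_
  have := (one_lt_div hp0).2 hp1
  linarith

/-- The constant of `errHp_le`, before extracting the root of order `p`. -/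
noncomputable def errConst (p : ℝ) (L : ℕ) : ℝ≥0∞ :=
  (L : ℝ≥0∞) ^ p * (1 - (2 : ℝ≥0∞)⁻¹ ^ (1 - p))⁻¹ * (L : ℝ≥0∞) ^ (1 - p) + 1

lemma errConst_ne_top {p : ℝ} (hp0 : 0 < p) (hp1 : p < 1) (L : ℕ) : errConst p L ≠ ∞ := by
  have h2 : (2 : ℝ≥0∞)⁻¹ ^ (1 - p) < 1 :=
    ENNReal.rpow_lt_one (ENNReal.inv_lt_one.2 (by norm_num)) (by linarith)
  refine ENNReal.add_ne_top.2 ⟨ENNReal.mul_ne_top (ENNReal.mul_ne_top ?_ ?_) ?_, ENNReal.one_ne_top⟩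
  · exact ENNReal.rpow_ne_top_of_nonneg hp0.le (ENNReal.natCast_ne_top _)
  · exact ENNReal.inv_ne_top.2 (tsub_pos_of_lt h2).ne'
  · exact ENNReal.rpow_ne_top_of_nonneg (by linarith) (ENNReal.natCast_ne_top _)

lemma errHp_le (m : ℕ → ℕ) [Generator m] {p : ℝ} (hp0 : 0 < p) (hp1 : p < 1)
    {L : ℕ} (hL : ∀ j, m j ≤ L) {f : ℕ → G m → ℂ} (hf : Martingale f (filtration m) (haar m))
    {k n : ℕ} (h1 : M m k < n) (h2 : n ≤ M m (k + 1)) :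
    errHp m p n f ≤ errConst p L ^ (1 / p) * ratio m p n * omega m p k f := by
  have hn0 : n ≠ 0 := by omega
  have hq : 0 < 1 - p := by linarith
  rw [errHp_eq m hf, omega_eq m hf]
  set a := martCoeff m f
  -- These are the coefficients of `f - S_{M_k} f`, so `psum m b n` is `S_n f - S_{M_k} f`.
  set b : ℕ → ℂ := fun i => if M m k ≤ i then a i else 0
  set g : G m → ℝ≥0∞ := fun x => ⨆ l, ‖psum m a (M m l) x - psum m a (min (M m k) (M m l)) x‖ₑ
  have hk : ∀ l, k ≤ l → min (M m k) (M m l) = M m k := fun l hl => min_eq_left (M_mono m hl)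
  have hpt : ∀ x, (⨆ l, ‖psum m a (min n (M m l)) x - psum m a (M m l) x‖ₑ) ≤
      ‖psum m b n x‖ₑ + g x := by
    intro x
    refine iSup_le fun l => ?_
    rcases le_or_gt l k with hl | hl
    · rw [min_eq_right ((M_mono m hl).trans h1.le)]
      simp
    · rw [min_eq_left (h2.trans (M_mono m hl)), ← psum_sub m a h1.le x]
      have e : psum m a n x - psum m a (M m l) x = (psum m a n x - psum m a (M m k) x) -
          (psum m a (M m l) x - psum m a (M m k) x) := by ring
      rw [e]
      refine enorm_sub_le.trans (add_le_add le_rfl ?_)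
      have := le_iSup (fun l => ‖psum m a (M m l) x - psum m a (min (M m k) (M m l)) x‖ₑ) l
      rwa [hk l hl.le] at this
  have hb : ∀ x, ‖psum m b (M m (k + 1)) x‖ₑ ≤ g x := by
    intro x
    rw [← psum_sub m a (M_mono m (Nat.le_succ k)) x]
    have := le_iSup (fun l => ‖psum m a (M m l) x - psum m a (min (M m k) (M m l)) x‖ₑ) (k + 1)
    rwa [hk _ (Nat.le_succ k)] at this
  -- The level `k+1` is traded for `hi m n` at the price `L`; when `n = M_{k+1}` the top digit is
  -- already at `k+1`.
  have hM : M m (k + 1) ≤ L * M m (hi m n) := by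
    rcases h2.lt_or_eq with h | h
    · rw [hi_eq m h1.le h, M]
      exact Nat.mul_le_mul_right _ (hL k)
    · have : k + 1 ≤ hi m n := by
        by_contra! h3
        exact absurd (lt_M_hi_succ m n) (not_lt.2 ((M_mono m (Nat.succ_le_of_lt h3)).trans_eq h.symm))
      have h4 : 1 ≤ L := (hL 0).trans' (by have := Generator.two_le (m := m) 0; omega)
      exact (M_mono m this).trans (Nat.le_mul_of_pos_left _ h4)
  set R := (M m (hi m n) : ℝ≥0∞) / M m (lo m n) with hR
  have hR1 : 1 ≤ R ^ (1 - p) := ENNReal.one_le_rpow (one_le_M_div m (lo_le_hi m hn0)) hq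
  have hRK : ((M m (k + 1) : ℝ≥0∞) / M m (lo m n)) ^ (1 - p) ≤
      (L : ℝ≥0∞) ^ (1 - p) * R ^ (1 - p) := by
    rw [← ENNReal.mul_rpow_of_nonneg _ _ hq.le]
    refine ENNReal.rpow_le_rpow ?_ hq.le
    rw [hR, ← mul_div_assoc]
    gcongr
    exact_mod_cast hM
  have hint : ∫⁻ x, (⨆ l, ‖psum m a (min n (M m l)) x - psum m a (M m l) x‖ₑ) ^ p ∂(haar m) ≤
      errConst p L * R ^ (1 - p) * ∫⁻ x, g x ^ p ∂(haar m) := by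
    calc _ ≤ ∫⁻ x, (‖psum m b n x‖ₑ ^ p + g x ^ p) ∂(haar m) := by
          refine lintegral_mono fun x => ?_
          exact (ENNReal.rpow_le_rpow (hpt x) hp0.le).trans
            (ENNReal.rpow_add_le_add_rpow _ _ hp0.le hp1.le)
      _ = ∫⁻ x, ‖psum m b n x‖ₑ ^ p ∂(haar m) + ∫⁻ x, g x ^ p ∂(haar m) :=
          lintegral_add_left ((measurable_psum m b n).enorm.pow_const p) _
      _ ≤ (L : ℝ≥0∞) ^ p * (1 - (2 : ℝ≥0∞)⁻¹ ^ (1 - p))⁻¹ *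
          ((L : ℝ≥0∞) ^ (1 - p) * R ^ (1 - p)) * ∫⁻ x, g x ^ p ∂(haar m) +
          R ^ (1 - p) * ∫⁻ x, g x ^ p ∂(haar m) := by
          refine add_le_add ?_ (le_mul_of_one_le_left zero_le hR1)
          refine (lintegral_enorm_psum_rpow_le m hp0 hp1 hL b h2).trans ?_
          refine mul_le_mul' (mul_le_mul' le_rfl hRK) (lintegral_mono fun x => ?_)
          exact ENNReal.rpow_le_rpow (hb x) hp0.le
      _ = _ := by rw [errConst]; ring
  have hratio : ratio m p n = (R ^ (1 - p)) ^ (1 / p) := by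
    rw [← ENNReal.rpow_mul, ratio]
    congr 1; field_simp
  have h1p : 0 ≤ 1 / p := by positivity
  rw [hpNorm, hpNorm, hratio, ← ENNReal.mul_rpow_of_nonneg _ _ h1p,
    ← ENNReal.mul_rpow_of_nonneg _ _ h1p]
  exact ENNReal.rpow_le_rpow hint h1p

lemma errHp_le_omega_hi (m : ℕ → ℕ) [Generator m] {p : ℝ} (hp0 : 0 < p) (hp1 : p < 1)
    {L : ℕ} (hL : ∀ j, m j ≤ L) {f : ℕ → G m → ℂ} (hf : Martingale f (filtration m) (haar m))
    {n : ℕ} (hn : n ≠ 0) :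
    errHp m p n f ≤ errConst p L ^ (1 / p) * (omega m p (hi m n) f * ratio m p n) := by
  rcases (M_hi_le m hn).lt_or_eq with h | h
  · refine (errHp_le m hp0 hp1 hL hf h (lt_M_hi_succ m n).le).trans_eq ?_
    ring
  -- For `n = M_{|n|}` the error is the modulus itself, and both remaining factors are at least `1`.
  · have h1 : 1 ≤ errConst p L ^ (1 / p) :=
      ENNReal.one_le_rpow (by rw [errConst]; exact le_add_self) (by positivity)
    have e : errHp m p n f = omega m p (hi m n) f := by rw [← errHp_M m hf, h]
    rw [e]
    exact (le_mul_of_one_le_right zero_le (one_le_ratio m hp0 hp1 hn)).trans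
      (le_mul_of_one_le_left zero_le h1)

lemma tendsto_errHp (m : ℕ → ℕ) [Generator m] {p : ℝ} (hp0 : 0 < p) (hp1 : p < 1)
    {L : ℕ} (hL : ∀ j, m j ≤ L) {f : ℕ → G m → ℂ} (hf : Martingale f (filtration m) (haar m))
    {n : ℕ → ℕ} (hn : StrictMono n)
    (h : Tendsto (fun k => omega m p (hi m (n k)) f * ratio m p (n k)) atTop (𝓝 0)) :
    Tendsto (fun k => errHp m p (n k) f) atTop (𝓝 0) := by
  have hc : errConst p L ^ (1 / p) ≠ ∞ :=
    ENNReal.rpow_ne_top_of_nonneg (by positivity) (errConst_ne_top hp0 hp1 L)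
  have h2 := ENNReal.Tendsto.const_mul h (Or.inr hc)
  rw [mul_zero] at h2
  refine tendsto_of_tendsto_of_tendsto_of_le_of_le' tendsto_const_nhds h2
    (Eventually.of_forall fun _ => zero_le) ?_
  -- The first term of the sequence may be `0`.
  filter_upwards [eventually_ge_atTop 1] with k hk
  exact errHp_le_omega_hi m hp0 hp1 hL hf (by have := hn.id_le k; simp at this; omega)

end Approximation

/-! ### Lower bound for the kernel -/

section LowerBound

/-- The neutral element of `G m`. -/
def origin (m : ℕ → ℕ) [Generator m] : G m :=
  fun k => ⟨0, lt_of_lt_of_le two_pos (Generator.two_le k)⟩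

lemma rademacher_origin (m : ℕ → ℕ) [Generator m] (k : ℕ) : rademacher m k (origin m) = 1 := by
  simp [rademacher_eq, origin]

lemma psi_origin (m : ℕ → ℕ) [Generator m] (n : ℕ) : psi m n (origin m) = 1 := by
  simp [psi, rademacher_origin]

lemma dirichlet_mul_M_eq_zero (m : ℕ → ℕ) [Generator m] (a : ℕ) {j : ℕ} {x y : G m}
    (h : y ∉ I m j x) : dirichlet m (a * M m j) x y = 0 := by
  induction a with
  | zero => simp [dirichlet]
  | succ a ih =>
    rw [Nat.succ_mul, dirichlet_mul_M_add m a le_rfl, ih, dirichlet_M, if_neg h]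
    simp

lemma norm_pow_sub_one_le {z : ℂ} (hz : ‖z‖ = 1) (n : ℕ) :
    ‖z ^ n - 1‖ ≤ 2 * ‖∑ b ∈ Finset.range n, z ^ b‖ := by
  rw [← geom_sum_mul, norm_mul, mul_comm]
  refine mul_le_mul_of_nonneg_right ((norm_sub_le _ _).trans ?_) (norm_nonneg _)
  rw [hz, norm_one]; norm_num

/-- Away from the next interval the kernel is governed by the lowest nonzero digit. -/
lemma le_norm_dirichlet (m : ℕ → ℕ) [Generator m] {n : ℕ} {x : G m}
    (hx : x ∈ I m (lo m n) (origin m))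
    (h1 : 1 ≤ ‖rademacher m (lo m n) x ^ digit m n (lo m n) - 1‖) :
    (M m (lo m n) : ℝ) / 2 ≤ ‖dirichlet m n x (origin m)‖ := by
  set s := lo m n
  have hne : origin m ∉ I m (s + 1) x := by
    intro h
    have : rademacher m s x = 1 := by
      rw [← rademacher_origin m s, rademacher_inj]
      exact (h s (by omega)).symm
    rw [this] at h1
    norm_num at h1
  have hdig : digit m n s < m s := Nat.mod_lt _ (by have := Generator.two_le (m := m) s; omega)
  -- The multiple of `M_{s+1}` has a kernel vanishing off `I_{s+1}`; what remains is a geometric sum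
  -- of `n_s` terms times `M_s`.
  have e : n = n / M m (s + 1) * M m (s + 1) + digit m n s * M m s := by
    rw [← div_M_mul_M, Nat.div_mul_cancel (M_lo_dvd m n)]
  have hle : digit m n s * M m s ≤ M m (s + 1) := Nat.mul_le_mul_right _ hdig.le
  have e2 : ‖dirichlet m n x (origin m)‖ =
      ‖∑ b ∈ Finset.range (digit m n s), rademacher m s x ^ b‖ * M m s := by
    conv_lhs => rw [e]
    rw [dirichlet_mul_M_add m _ hle, dirichlet_mul_M_eq_zero m _ hne, zero_add, norm_mul, norm_mul,
      RCLike.norm_conj, norm_psi, norm_psi, dirichlet_mul_M m hdig.le, dirichlet_M,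
      if_pos ((mem_I_comm m).1 hx), rademacher_origin]
    simp
  rw [e2]
  have := norm_pow_sub_one_le (norm_rademacher m s x) (digit m n s)
  have hM : (0 : ℝ) ≤ M m s := by positivity
  nlinarith

lemma sum_normSq_zeta (m : ℕ → ℕ) [Generator m] {k n : ℕ} (hn0 : n ≠ 0) (hn : n < m k) :
    ∑ a ∈ Finset.range (m k), ‖(zeta m k ^ a) ^ n - 1‖ ^ 2 = 2 * m k := by
  have hz : zeta m k ^ n ≠ 1 := (zeta_primitive m k).pow_ne_one_of_pos_of_lt hn0 hn
  have hs : ∑ a ∈ Finset.range (m k), (zeta m k ^ a) ^ n = 0 := by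
    have : ∀ a, (zeta m k ^ a) ^ n = (zeta m k ^ n) ^ a := fun a => by ring
    simp only [this]
    rw [geom_sum_eq hz, ← pow_mul, mul_comm, pow_mul, (zeta_primitive m k).pow_eq_one]
    simp
  have e : ∀ a, ‖(zeta m k ^ a) ^ n - 1‖ ^ 2 = 2 - 2 * ((zeta m k ^ a) ^ n).re := by
    intro a
    have h1 : ‖(zeta m k ^ a) ^ n‖ ^ 2 = 1 := by simp [norm_zeta]
    rw [← Complex.normSq_eq_norm_sq, Complex.normSq_apply] at h1 ⊢
    simp only [Complex.sub_re, Complex.sub_im, Complex.one_re, Complex.one_im]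
    linarith
  simp only [e, Finset.sum_sub_distrib, ← Finset.mul_sum, ← Complex.re_sum, hs]
  simp; ring

/-- The mean of `|z^n - 1|²` over the `m_k`-th roots of unity is `2`, while each value is at most
`4`. If the proportion with `|z^n - 1| ≥ 1` is `P`, then `2 ≤ 1 + 3P`. -/
lemma third_le_uniformOn (m : ℕ → ℕ) [Generator m] {k n : ℕ} (hn0 : n ≠ 0) (hn : n < m k) :
    (3 : ℝ≥0∞)⁻¹ ≤ (uniformOn Set.univ : Measure (Fin (m k)))
      {a | 1 ≤ ‖(zeta m k ^ (a : ℕ)) ^ n - 1‖} := by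
  classical
  set T : Finset (Fin (m k)) := Finset.univ.filter fun a => 1 ≤ ‖(zeta m k ^ (a : ℕ)) ^ n - 1‖
  have hcard : m k ≤ 3 * T.card := by
    have h := sum_normSq_zeta m hn0 hn
    rw [← Fin.sum_univ_eq_sum_range (fun a => ‖(zeta m k ^ a) ^ n - 1‖ ^ 2)] at h
    have hle : ∑ a : Fin (m k), ‖(zeta m k ^ (a : ℕ)) ^ n - 1‖ ^ 2 ≤
        ∑ a : Fin (m k), (1 + if a ∈ T then (3 : ℝ) else 0) := by
      refine Finset.sum_le_sum fun a _ => ?_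
      have h0 := norm_nonneg ((zeta m k ^ (a : ℕ)) ^ n - 1)
      split_ifs with ha
      · have : ‖(zeta m k ^ (a : ℕ)) ^ n - 1‖ ≤ 2 := by
          refine (norm_sub_le _ _).trans ?_
          simp [norm_zeta]; norm_num
        nlinarith
      · have : ‖(zeta m k ^ (a : ℕ)) ^ n - 1‖ < 1 := by simpa [T] using ha
        nlinarith
    rw [h, Finset.sum_add_distrib, Finset.sum_ite_mem] at hle
    simp at hle
    have : (m k : ℝ) ≤ 3 * T.card := by linarith
    exact_mod_cast this
  have hset : {a : Fin (m k) | 1 ≤ ‖(zeta m k ^ (a : ℕ)) ^ n - 1‖} = (T : Set (Fin (m k))) := by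
    ext a; simp [T]
  have hm : (m k : ℝ≥0∞) ≠ 0 := by
    have := Generator.two_le (m := m) k
    exact_mod_cast (by omega : m k ≠ 0)
  rw [hset, uniformOn_univ, Measure.count_apply_finset, Fintype.card_fin,
    ENNReal.le_div_iff_mul_le (Or.inl hm) (Or.inl (ENNReal.natCast_ne_top _)), mul_comm,
    ← div_eq_mul_inv]
  refine ENNReal.div_le_of_le_mul ?_
  rw [mul_comm]
  exact_mod_cast hcard

lemma le_haar_lower_set (m : ℕ → ℕ) [Generator m] {s n : ℕ} (hn0 : n ≠ 0) (hn : n < m s) :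
    (M m s : ℝ≥0∞)⁻¹ * 3⁻¹ ≤
      haar m {x | x ∈ I m s (origin m) ∧ 1 ≤ ‖rademacher m s x ^ n - 1‖} := by
  have hI := haar_I m s (origin m)
  have h1 : I m s (origin m) = Set.pi (Finset.range s : Set ℕ) fun k => {origin m k} := by
    ext y; simp [I, Set.mem_pi]
  rw [h1, haar_pi] at hI
  let t : (k : ℕ) → Set (Fin (m k)) := fun k =>
    if k < s then {origin m k} else {a | 1 ≤ ‖(zeta m k ^ (a : ℕ)) ^ n - 1‖}
  have h2 : {x : G m | x ∈ I m s (origin m) ∧ 1 ≤ ‖rademacher m s x ^ n - 1‖} =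
      Set.pi (Finset.range (s + 1) : Set ℕ) t := by
    ext x
    simp only [Set.mem_ofPred_eq, Set.mem_pi, Finset.coe_range, Set.mem_Iio, I, t]
    constructor
    · rintro ⟨h, h'⟩ i hi
      rcases Nat.lt_succ_iff_lt_or_eq.1 hi with hi | rfl
      · simp [hi, h i hi]
      · simpa [rademacher_eq] using h'
    · intro h
      refine ⟨fun i hi => ?_, ?_⟩
      · have := h i (by omega); simpa [hi] using this
      · have := h s (by omega); simpa [rademacher_eq] using this
  rw [h2, haar_pi, Finset.prod_range_succ]
  have h3 : ∏ k ∈ Finset.range s, (uniformOn Set.univ : Measure (Fin (m k))) (t k) =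
      (M m s : ℝ≥0∞)⁻¹ := by
    rw [← hI]
    refine Finset.prod_congr rfl fun k hk => ?_
    simp only [t, if_pos (Finset.mem_range.1 hk)]
  rw [h3]
  refine mul_le_mul' le_rfl ?_
  simpa [t] using third_le_uniformOn m hn0 hn

end LowerBound

/-! ### The block series -/

section BlockSeries

/-- The coefficients of the series `∑_k w_k ∑_{i ∈ [d_k M_{h_k}, (d_k+1) M_{h_k})} ψ_i`. -/
noncomputable def blockCoeff (m : ℕ → ℕ) (h d : ℕ → ℕ) (w : ℕ → ℝ) (i : ℕ) : ℂ :=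
  ∑ k ∈ Finset.range (i + 1),
    if d k * M m (h k) ≤ i ∧ i < (d k + 1) * M m (h k) then (w k : ℂ) else 0

lemma sum_filter_psi (m : ℕ → ℕ) [Generator m] {u v : ℕ} (huv : u ≤ v) (n : ℕ) (x : G m) :
    (∑ i ∈ Finset.range n, if u ≤ i ∧ i < v then psi m i x else 0) =
      dirichlet m (min n v) x (origin m) - dirichlet m (min n u) x (origin m) := by
  have h : min n u ≤ min n v := min_le_min le_rfl huv
  simp only [dirichlet, psi_origin, map_one, mul_one]
  rw [← Finset.sum_range_add_sum_Ico _ h, add_sub_cancel_left, ← Finset.sum_filter]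
  refine Finset.sum_congr ?_ fun _ _ => rfl
  ext i
  simp only [Finset.mem_filter, Finset.mem_range, Finset.mem_Ico]
  omega

variable (m : ℕ → ℕ) [Generator m] {h d : ℕ → ℕ} (hh : StrictMono h) (hd : ∀ k, d k ≠ 0)
  (hdm : ∀ k, d k < m (h k)) (w : ℕ → ℝ)

include hh hd in
lemma psum_blockCoeff {n N : ℕ} (hN : n ≤ N) (x : G m) :
    psum m (blockCoeff m h d w) n x = ∑ k ∈ Finset.range N, (w k : ℂ) *
      (dirichlet m (min n ((d k + 1) * M m (h k))) x (origin m) -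
        dirichlet m (min n (d k * M m (h k))) x (origin m)) := by
  have e : ∀ i ∈ Finset.range n, blockCoeff m h d w i * psi m i x =
      ∑ k ∈ Finset.range N, (w k : ℂ) *
        (if d k * M m (h k) ≤ i ∧ i < (d k + 1) * M m (h k) then psi m i x else 0) := by
    intro i hi
    have hi' := Finset.mem_range.1 hi
    have e1 : blockCoeff m h d w i = ∑ k ∈ Finset.range N,
        if d k * M m (h k) ≤ i ∧ i < (d k + 1) * M m (h k) then (w k : ℂ) else 0 := by
      -- Block `k` starts at or after `M_{h_k} > h_k ≥ k`, so indices `k > i` contribute nothing.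
      refine Finset.sum_subset (by simpa using by omega) fun k _ hk => if_neg ?_
      rintro ⟨h1, -⟩
      have h2 := lt_M m (h k)
      have h3 := hh.id_le k
      have h4 : M m (h k) ≤ d k * M m (h k) :=
        Nat.le_mul_of_pos_left _ (Nat.pos_of_ne_zero (hd k))
      simp only [Finset.mem_range, id] at hk h3
      omega
    rw [e1, Finset.sum_mul]
    refine Finset.sum_congr rfl fun k _ => ?_
    split_ifs <;> simp
  rw [psum, Finset.sum_congr rfl e, Finset.sum_comm]
  refine Finset.sum_congr rfl fun k _ => ?_
  rw [← Finset.mul_sum, sum_filter_psi m (Nat.mul_le_mul_right _ (Nat.le_succ _))]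

/-- The majorant of the part of the block series with `h_k ≥ l`. -/
noncomputable def blockMajorant (h : ℕ → ℕ) (w : ℕ → ℝ) (l : ℕ) (x : G m) : ℝ≥0∞ :=
  ∑' k, if l ≤ h k then
    (I m (h k) (origin m)).indicator (fun _ => ‖w k‖ₑ * (M m (h k) : ℝ≥0∞)) x else 0

include hh hd hdm in
-- Block `k` lies between `M_{h_k}` and `M_{h_k + 1}`, so a sum of order `M_l` contains it entirely
-- or not at all. A full block is `w_k ψ_{d_k M_{h_k}} D_{M_{h_k}}`.
lemma enorm_psum_blockCoeff_sub_le {l₀ l : ℕ} (hl : l₀ ≤ l) (x : G m) :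
    ‖psum m (blockCoeff m h d w) (M m l) x - psum m (blockCoeff m h d w) (M m l₀) x‖ₑ ≤
      blockMajorant m h w l₀ x := by
  classical
  have htop : ∀ {k j}, h k < j → (d k + 1) * M m (h k) ≤ M m j := fun {k j} hk =>
    (Nat.mul_le_mul_right _ (hdm k)).trans (M_mono m (Nat.succ_le_of_lt hk))
  have hbot : ∀ {k j}, j ≤ h k → M m j ≤ d k * M m (h k) := fun {k j} hk =>
    (M_mono m hk).trans (Nat.le_mul_of_pos_left _ (Nat.pos_of_ne_zero (hd k)))
  have hbt : ∀ k, d k * M m (h k) ≤ (d k + 1) * M m (h k) := fun k =>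
    Nat.mul_le_mul_right _ (Nat.le_succ _)
  rw [psum_blockCoeff m hh hd w le_rfl, psum_blockCoeff m hh hd w (M_mono m hl),
    ← Finset.sum_sub_distrib]
  refine (enorm_sum_le _ _).trans ((Finset.sum_le_sum fun k _ => ?_).trans
    (ENNReal.sum_le_tsum (Finset.range (M m l))))
  rw [← mul_sub, enorm_mul]
  rcases lt_or_ge (h k) l₀ with hk | hk
  · rw [min_eq_right (htop hk), min_eq_right (htop (hk.trans_le hl)),
      min_eq_right ((hbt k).trans (htop hk)), min_eq_right ((hbt k).trans (htop (hk.trans_le hl)))]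
    simp
  · rw [if_pos hk, min_eq_left (hbot hk), min_eq_left ((hbot hk).trans (hbt k)), sub_self, sub_zero]
    rcases lt_or_ge (h k) l with hk' | hk'
    · rw [min_eq_right (htop hk'), min_eq_right ((hbt k).trans (htop hk')), Nat.succ_mul,
        dirichlet_mul_M_add m _ le_rfl, add_sub_cancel_left, dirichlet_M, Set.indicator_apply]
      have hpsi : ∀ i y, ‖psi m i y‖ₑ = 1 := fun i y => by
        rw [← ofReal_norm, norm_psi, ENNReal.ofReal_one]
      have hr : ‖(w k : ℂ)‖ₑ = ‖w k‖ₑ := by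
        rw [← ofReal_norm, ← ofReal_norm, Complex.norm_real]
      have hN : ‖(M m (h k) : ℂ)‖ₑ = M m (h k) := by
        rw [← ofReal_norm, Complex.norm_natCast, ENNReal.ofReal_natCast]
      simp only [mem_I_comm m (x := x), enorm_mul, hpsi, hr, psi_origin]
      split_ifs <;> simp [hN]
    · rw [min_eq_left (hbot hk'), min_eq_left ((hbot hk').trans (hbt k))]
      simp

lemma blockMajorant_eq_zero {l : ℕ} {x : G m} (hx : x ∉ I m l (origin m)) :
    blockMajorant m h w l x = 0 := by
  rw [blockMajorant, ENNReal.tsum_eq_zero]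
  intro k
  split_ifs with hk
  · exact Set.indicator_of_notMem (fun hx' => hx (I_anti m hk _ hx')) _
  · rfl

include hh hd hdm in
lemma psum_blockCoeff_eq_of_notMem {l₀ l : ℕ} (hl : l₀ ≤ l) {x : G m}
    (hx : x ∉ I m l₀ (origin m)) :
    psum m (blockCoeff m h d w) (M m l) x = psum m (blockCoeff m h d w) (M m l₀) x := by
  have := enorm_psum_blockCoeff_sub_le m hh hd hdm w hl x
  rw [blockMajorant_eq_zero m w hx, nonpos_iff_eq_zero, enorm_eq_zero, sub_eq_zero] at this
  exact this

include hh hd hdm in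
lemma tendsto_psum_blockCoeff {l₀ : ℕ} {x : G m} (hx : x ∉ I m l₀ (origin m)) :
    Tendsto (fun l => psum m (blockCoeff m h d w) (M m l) x) atTop
      (𝓝 (psum m (blockCoeff m h d w) (M m l₀) x)) := by
  refine tendsto_const_nhds.congr' ?_
  filter_upwards [eventually_ge_atTop l₀] with l hl
  exact (psum_blockCoeff_eq_of_notMem m hh hd hdm w hl hx).symm

/-- The intervals around the origin shrink to a null set; elsewhere the series has only finitely
many nonzero blocks. -/
lemma ae_exists_notMem_I : ∀ᵐ x ∂(haar m), ∃ l, x ∉ I m l (origin m) := by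
  rw [ae_iff]
  by_contra hne
  obtain ⟨n, hn⟩ := ENNReal.exists_inv_nat_lt hne
  have h1 : haar m {x | ¬∃ l, x ∉ I m l (origin m)} ≤ haar m (I m n (origin m)) := by
    refine measure_mono fun x hx => ?_
    by_contra hx'
    exact hx ⟨n, hx'⟩
  rw [haar_I] at h1
  have h2 : (M m n : ℝ≥0∞)⁻¹ ≤ (n : ℝ≥0∞)⁻¹ :=
    ENNReal.inv_le_inv.2 (by exact_mod_cast (lt_M m n).le)
  exact absurd hn (not_lt.2 (h1.trans h2))

include hh hd hdm in
-- Earlier blocks are complete in both sums and later ones have not begun. Block `K` leaves `D_n`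
-- minus the kernel of order `d_K M_{h_K}`, and the latter vanishes off `I_{h_K}(0)`.
lemma psum_blockCoeff_sub_of_mem_block {K n : ℕ} (h1 : d K * M m (h K) ≤ n)
    (h2 : n ≤ (d K + 1) * M m (h K)) {x : G m} (hx : x ∉ I m (h K) (origin m)) :
    psum m (blockCoeff m h d w) n x - psum m (blockCoeff m h d w) (M m (h K)) x =
      w K * dirichlet m n x (origin m) := by
  have hbt : ∀ k, d k * M m (h k) ≤ (d k + 1) * M m (h k) := fun k =>
    Nat.mul_le_mul_right _ (Nat.le_succ _)
  have hMd : ∀ k, M m (h k) ≤ d k * M m (h k) := fun k =>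
    Nat.le_mul_of_pos_left _ (Nat.pos_of_ne_zero (hd k))
  have htop : ∀ {k j}, k < j → (d k + 1) * M m (h k) ≤ M m (h j) := fun {k j} hk =>
    (Nat.mul_le_mul_right _ (hdm k)).trans (M_mono m (Nat.succ_le_of_lt (hh hk)))
  have hKn : K < n := by
    have := lt_M m (h K)
    have h3 := hh.id_le K
    have := hMd K
    simp only [id] at h3
    omega
  rw [psum_blockCoeff m hh hd w le_rfl, psum_blockCoeff m hh hd w ((hMd K).trans h1),
    ← Finset.sum_sub_distrib, Finset.sum_eq_single K]
  · rw [min_eq_left (hMd K), min_eq_left ((hMd K).trans (hbt K)), min_eq_left h2, min_eq_right h1,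
      dirichlet_mul_M_eq_zero m (d K) (fun h' => hx ((mem_I_comm m).1 h'))]
    ring
  · intro k _ hk
    rcases lt_or_gt_of_ne hk with hk | hk
    · have h3 := htop hk
      have h4 := (hMd K).trans h1
      rw [min_eq_right h3, min_eq_right (h3.trans h4), min_eq_right ((hbt k).trans h3),
        min_eq_right ((hbt k).trans (h3.trans h4))]
      ring
    · have h3 : n ≤ d k * M m (h k) := h2.trans ((htop hk).trans (hMd k))
      have h4 := (hMd K).trans h1
      rw [min_eq_left h3, min_eq_left (h3.trans (hbt k)), min_eq_left (h4.trans h3),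
        min_eq_left (h4.trans (h3.trans (hbt k)))]
      ring
  · intro h3
    exact absurd (Finset.mem_range.2 hKn) h3

end BlockSeries

/-! ### Hardy norms of the block series -/

section BlockSeriesNorms

lemma rpow_tsum_le (u : ℕ → ℝ≥0∞) {p : ℝ} (hp0 : 0 < p) (hp1 : p ≤ 1) :
    (∑' k, u k) ^ p ≤ ∑' k, u k ^ p := by
  rw [← ENNReal.le_rpow_inv_iff hp0]
  refine ENNReal.tsum_le_of_sum_range_le fun n => ?_
  rw [ENNReal.le_rpow_inv_iff hp0]
  exact (rpow_sum_le _ _ hp0 hp1).trans (ENNReal.sum_le_tsum _)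

lemma tsum_tail_le {q : ℕ → ℝ≥0∞} (hq : ∀ k, 2 * q (k + 1) ≤ q k) {h : ℕ → ℕ} (hh : StrictMono h)
    (K : ℕ) : ∑' k, (if h K ≤ h k then q k else 0) ≤ 2 * q K := by
  have hgeo : ∀ t, q (t + K) ≤ q K * (2 : ℝ≥0∞)⁻¹ ^ t := by
    intro t
    induction t with
    | zero => simp
    | succ t ih =>
      have h1 := hq (t + K)
      rw [mul_comm, ← ENNReal.le_div_iff_mul_le (by simp) (by simp), div_eq_mul_inv] at h1
      rw [show t + 1 + K = t + K + 1 by ring, pow_succ, ← mul_assoc]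
      exact h1.trans (mul_le_mul_left ih _)
  rw [← ENNReal.summable.sum_add_tsum_nat_add' (k := K), Finset.sum_eq_zero, zero_add]
  · calc _ ≤ ∑' t, q K * (2 : ℝ≥0∞)⁻¹ ^ t := by
          refine ENNReal.tsum_le_tsum fun t => ?_
          split_ifs
          · exact hgeo t
          · exact zero_le
      _ = 2 * q K := by
          rw [ENNReal.tsum_mul_left, ENNReal.tsum_geometric, ENNReal.one_sub_inv_two, inv_inv,
            mul_comm]
  · intro k hk
    rw [if_neg]
    exact not_le.2 (hh (Finset.mem_range.1 hk))

variable (m : ℕ → ℕ) [Generator m] {h d : ℕ → ℕ} (hh : StrictMono h) (hd : ∀ k, d k ≠ 0)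
  (hdm : ∀ k, d k < m (h k)) (w : ℕ → ℝ)

lemma lintegral_blockMajorant_rpow_le (h : ℕ → ℕ) (l : ℕ) {p : ℝ} (hp0 : 0 < p) (hp1 : p ≤ 1) :
    ∫⁻ x, blockMajorant m h w l x ^ p ∂(haar m) ≤
      ∑' k, if l ≤ h k then (‖w k‖ₑ * (M m (h k) : ℝ≥0∞)) ^ p * (M m (h k) : ℝ≥0∞)⁻¹ else 0 := by
  have hmeas : ∀ k, Measurable fun x => if l ≤ h k then (I m (h k) (origin m)).indicator
      (fun _ => (‖w k‖ₑ * (M m (h k) : ℝ≥0∞)) ^ p) x else 0 := by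
    intro k
    split_ifs
    · exact measurable_const.indicator (measurableSet_I m _ _)
    · exact measurable_const
  calc _ ≤ ∫⁻ x, ∑' k, (if l ≤ h k then (I m (h k) (origin m)).indicator
        (fun _ => (‖w k‖ₑ * (M m (h k) : ℝ≥0∞)) ^ p) x else 0) ∂(haar m) := by
        refine lintegral_mono fun x => (rpow_tsum_le _ hp0 hp1).trans_eq (tsum_congr fun k => ?_)
        classical
        simp only [Set.indicator_apply]
        split_ifs <;> simp [hp0]
    _ = ∑' k, ∫⁻ x, (if l ≤ h k then (I m (h k) (origin m)).indicator
        (fun _ => (‖w k‖ₑ * (M m (h k) : ℝ≥0∞)) ^ p) x else 0) ∂(haar m) :=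
        lintegral_tsum fun k => (hmeas k).aemeasurable
    _ = _ := by
        refine tsum_congr fun k => ?_
        split_ifs
        · rw [lintegral_indicator_const (measurableSet_I m _ _), haar_I]
        · simp

include hh hd hdm in
lemma hpNorm_psum_blockCoeff_sub_le (l₀ : ℕ) {p : ℝ} (hp0 : 0 < p) (hp1 : p ≤ 1) :
    hpNorm m p (fun l x => psum m (blockCoeff m h d w) (M m l) x -
      psum m (blockCoeff m h d w) (min (M m l₀) (M m l)) x) ≤
    (∑' k, if l₀ ≤ h k then (‖w k‖ₑ * (M m (h k) : ℝ≥0∞)) ^ p * (M m (h k) : ℝ≥0∞)⁻¹ else 0) ^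
      (1 / p) := by
  refine ENNReal.rpow_le_rpow (le_trans ?_ (lintegral_blockMajorant_rpow_le m w h l₀ hp0 hp1))
    (by positivity)
  refine lintegral_mono fun x => ENNReal.rpow_le_rpow (iSup_le fun l => ?_) hp0.le
  beta_reduce
  rcases le_total l₀ l with hl | hl
  · rw [min_eq_left (M_mono m hl)]
    exact enorm_psum_blockCoeff_sub_le m hh hd hdm w hl x
  · rw [min_eq_right (M_mono m hl)]
    simp

lemma enorm_natCast_rpow {N : ℕ} (hN : 0 < N) (r : ℝ) : ‖(N : ℝ) ^ r‖ₑ = (N : ℝ≥0∞) ^ r := by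
  rw [Real.enorm_of_nonneg (by positivity), ← ENNReal.ofReal_rpow_of_pos (by exact_mod_cast hN),
    ENNReal.ofReal_natCast]

/-- The weight `M_s^(1/p-1)` is chosen so that the `p`-th power integral of a block is this ratio.
-/
lemma block_term_eq {p : ℝ} (hp0 : 0 < p) (hp1 : p < 1) (s h : ℕ) :
    (‖(M m s : ℝ) ^ (1 / p - 1)‖ₑ * (M m h : ℝ≥0∞)) ^ p * (M m h : ℝ≥0∞)⁻¹ =
      ((M m s : ℝ≥0∞) / M m h) ^ (1 - p) := by
  have hM0 : (M m h : ℝ≥0∞) ≠ 0 := by exact_mod_cast (M_pos m h).ne'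
  rw [enorm_natCast_rpow (M_pos m s), ENNReal.mul_rpow_of_nonneg _ _ hp0.le, ← ENNReal.rpow_mul,
    mul_assoc, div_eq_mul_inv (M m s : ℝ≥0∞), ENNReal.mul_rpow_of_nonneg _ _ (by linarith)]
  congr 1
  · congr 1; field_simp
  · rw [← ENNReal.rpow_neg_one, ← ENNReal.rpow_add _ _ hM0 (ENNReal.natCast_ne_top _),
      ← ENNReal.rpow_mul]
    congr 1; ring

end BlockSeriesNorms

/-! ### Choice of the subsequence -/

section Subsequence

/-- `(M_{⟨n⟩} / M_{|n|})^{1-p}`. -/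
noncomputable def decay (m : ℕ → ℕ) (p : ℝ) (n : ℕ) : ℝ≥0∞ :=
  ((M m (lo m n) : ℝ≥0∞) / M m (hi m n)) ^ (1 - p)

lemma decay_rpow (m : ℕ → ℕ) [Generator m] {p : ℝ} (hp0 : 0 < p) (n : ℕ) :
    decay m p n ^ (1 / p) = (ratio m p n)⁻¹ := by
  rw [decay, ratio, ← ENNReal.rpow_mul, ← ENNReal.inv_rpow, ENNReal.inv_div
    (Or.inl (ENNReal.natCast_ne_top _)) (Or.inr ?_)]
  · congr 1; field_simp
  · exact_mod_cast (M_pos m _).ne'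

lemma decay_pos (m : ℕ → ℕ) [Generator m] {p : ℝ} (hp1 : p < 1) (n : ℕ) : decay m p n ≠ 0 := by
  rw [decay, Ne, ENNReal.rpow_eq_zero_iff_of_pos (by linarith), ENNReal.div_eq_zero_iff]
  push Not
  exact ⟨by exact_mod_cast (M_pos m _).ne', ENNReal.natCast_ne_top _⟩

lemma decay_le_one (m : ℕ → ℕ) [Generator m] {p : ℝ} (hp1 : p < 1) {n : ℕ} (hn : n ≠ 0) :
    decay m p n ≤ 1 := by
  refine ENNReal.rpow_le_one (ENNReal.div_le_of_le_mul ?_) (by linarith)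
  rw [one_mul]
  exact_mod_cast M_mono m (lo_le_hi m hn)

lemma decay_le (m : ℕ → ℕ) [Generator m] {p : ℝ} (hp1 : p < 1) {n : ℕ} (hn : n ≠ 0) :
    decay m p n ≤ ((2 : ℝ≥0∞)⁻¹ ^ (1 - p)) ^ rho m n := by
  have hq : 0 ≤ 1 - p := by linarith
  have h1 := rpow_div_M_add_le m hq (M m (lo m n)) (lo m n) (rho m n)
  have h2 : lo m n + rho m n = hi m n := by
    have := lo_le_hi m hn
    rw [rho]; omega
  rw [h2, ENNReal.div_self (by exact_mod_cast (M_pos m _).ne') (ENNReal.natCast_ne_top _),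
    ENNReal.one_rpow, one_mul] at h1
  exact h1

lemma hi_le (m : ℕ → ℕ) [Generator m] {n : ℕ} (hn : n ≠ 0) : hi m n ≤ n :=
  (lt_M m _).le.trans (M_hi_le m hn)

lemma exists_subsequence (m : ℕ → ℕ) [Generator m] {p : ℝ} (hp1 : p < 1)
    {n : ℕ → ℕ} (hn : StrictMono n) (hub : ¬ BddAbove (Set.range fun k => rho m (n k))) :
    ∃ φ : ℕ → ℕ, StrictMono φ ∧ (∀ k, lo m (n (φ k)) < hi m (n (φ k))) ∧
      StrictMono (fun k => hi m (n (φ k))) ∧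
      ∀ k, 2 * decay m p (n (φ (k + 1))) ≤ decay m p (n (φ k)) := by
  have hr : (2 : ℝ≥0∞)⁻¹ ^ (1 - p) < 1 :=
    ENNReal.rpow_lt_one (ENNReal.inv_lt_one.2 (by norm_num)) (by linarith)
  have hlim : Tendsto (fun B : ℕ => 2 * ((2 : ℝ≥0∞)⁻¹ ^ (1 - p)) ^ B) atTop (𝓝 0) := by
    have := ENNReal.Tendsto.const_mul (a := 2)
      (ENNReal.tendsto_pow_atTop_nhds_zero_of_lt_one hr) (Or.inr (by norm_num))
    rwa [mul_zero] at this
  obtain ⟨φ, hφ1, hφ2⟩ := exists_seq_of_forall_finset_exists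
    (fun x : ℕ => n x ≠ 0 ∧ lo m (n x) < hi m (n x))
    (fun x y : ℕ => x < y ∧ hi m (n x) < hi m (n y) ∧ 2 * decay m p (n y) ≤ decay m p (n x)) (by
      intro s hs
      -- Choosing the next index with `rho > B` serves all demands: its `decay` is at most
      -- `((1/2)^(1-p))^B`, and its `hi` exceeds every earlier `n x`, hence every earlier `hi`.
      have hev : ∀ᶠ B : ℕ in atTop, ∀ x ∈ s,
          n x < B ∧ 2 * ((2 : ℝ≥0∞)⁻¹ ^ (1 - p)) ^ B < decay m p (n x) := by
        rw [Filter.eventually_all_finset]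
        intro x _
        exact (eventually_gt_atTop _).and
          (hlim.eventually_lt_const (pos_iff_ne_zero.2 (decay_pos m hp1 _)))
      obtain ⟨B, hB⟩ := hev.exists
      obtain ⟨y, hy⟩ : ∃ y, B < rho m (n y) := by
        by_contra! hcon
        exact hub ⟨B, by rintro _ ⟨y, rfl⟩; exact hcon y⟩
      have hrho : rho m (n y) ≤ hi m (n y) := Nat.sub_le _ _
      have hy0 : n y ≠ 0 := by
        intro h0
        have h1 : hi m 0 = 0 := by simp [hi, digit]
        rw [h0] at hy hrho
        omega
      refine ⟨y, ⟨hy0, ?_⟩, fun x hx => ?_⟩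
      · rw [rho] at hy; omega
      · obtain ⟨h1, h2⟩ := hB x hx
        have h3 := hi_le m (hs x hx).1
        have h4 := hi_le m hy0
        refine ⟨hn.lt_iff_lt.1 (by omega), by omega, le_trans ?_ h2.le⟩
        refine mul_le_mul_right ((decay_le m hp1 hy0).trans ?_) _
        exact pow_le_pow_right_of_le_one' hr.le hy.le)
  refine ⟨φ, fun a b hab => (hφ2 a b hab).1, fun k => (hφ1 k).2, fun a b hab => (hφ2 a b hab).2.1,
    fun k => (hφ2 k (k + 1) (by omega)).2.2⟩

end Subsequence

/-! ### Divergence in weak `L_p` -/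

section Divergence

lemma weakNorm_ge (m : ℕ → ℕ) [Generator m] {p : ℝ} (hp0 : 0 < p) {s : ℕ} {A : Set (G m)}
    (hA : (M m s : ℝ≥0∞)⁻¹ * 3⁻¹ ≤ haar m A) {g : G m → ℂ}
    (hg : ∀ x ∈ A, (M m s : ℝ) ^ (1 / p - 1) * (M m s / 2) ≤ ‖g x‖) :
    (4 : ℝ≥0∞)⁻¹ * 3⁻¹ ^ (1 / p) ≤ weakNorm m p g := by
  have hp : 0 ≤ 1 / p := by positivity
  have hMR : (0 : ℝ) < M m s := by exact_mod_cast M_pos m s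
  have hM0 : (M m s : ℝ≥0∞) ≠ 0 := by exact_mod_cast (M_pos m s).ne'
  -- The given lower bound is `M_s^(1/p) / 2`; halving it again secures the strict inequality in the
  -- weak norm. The powers of `M_s` then cancel.
  set t : ℝ≥0 := (M m s : ℝ≥0) ^ (1 / p) * 4⁻¹ with ht
  have htE : (t : ℝ≥0∞) = (M m s : ℝ≥0∞) ^ (1 / p) * 4⁻¹ := by
    rw [ht, ENNReal.coe_mul, ENNReal.coe_rpow_of_nonneg _ hp, ENNReal.coe_inv (by norm_num)]
    simp
  have hsub : A ⊆ {x | (t : ℝ≥0∞) < ‖g x‖ₑ} := by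
    intro x hx
    have h1 := hg x hx
    have h2 : (t : ℝ) < ‖g x‖ := by
      have h3 : (M m s : ℝ) ^ (1 / p - 1) * (M m s / 2) = (M m s : ℝ) ^ (1 / p) / 2 := by
        rw [Real.rpow_sub_one hMR.ne']; field_simp
      have h4 : (0 : ℝ) < (M m s : ℝ) ^ (1 / p) := Real.rpow_pos_of_pos hMR _
      rw [h3] at h1
      have h5 : (t : ℝ) = (M m s : ℝ) ^ (1 / p) * 4⁻¹ := by
        rw [ht]; push_cast; rfl
      rw [h5]; linarith
    change (t : ℝ≥0∞) < ‖g x‖ₑ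
    rw [enorm_eq_nnnorm, ENNReal.coe_lt_coe]
    exact h2
  refine le_trans ?_ (le_iSup _ t)
  calc (4 : ℝ≥0∞)⁻¹ * 3⁻¹ ^ (1 / p) = t * ((M m s : ℝ≥0∞)⁻¹ * 3⁻¹) ^ (1 / p) := by
        rw [htE, ENNReal.mul_rpow_of_nonneg _ _ hp, ENNReal.inv_rpow (M m s : ℝ≥0∞)]
        have : (M m s : ℝ≥0∞) ^ (1 / p) * ((M m s : ℝ≥0∞) ^ (1 / p))⁻¹ = 1 :=
          ENNReal.mul_inv_cancel (by simp [hM0]) (by simp [hp0.le])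
        calc (4 : ℝ≥0∞)⁻¹ * 3⁻¹ ^ (1 / p) =
            ((M m s : ℝ≥0∞) ^ (1 / p) * ((M m s : ℝ≥0∞) ^ (1 / p))⁻¹) *
              ((4 : ℝ≥0∞)⁻¹ * 3⁻¹ ^ (1 / p)) := by rw [this, one_mul]
          _ = _ := by ring
    _ ≤ _ := by
        gcongr
        exact hA.trans (measure_mono hsub)

lemma exists_divergent (m : ℕ → ℕ) [Generator m] {p : ℝ} (hp0 : 0 < p) (hp1 : p < 1)
    {n : ℕ → ℕ} (hn : StrictMono n) (hub : ¬ BddAbove (Set.range fun k => rho m (n k))) :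
    ∃ (f : ℕ → G m → ℂ) (F : G m → ℂ) (φ : ℕ → ℕ), MemHp m p f ∧
      (∀ᵐ x ∂(haar m), Tendsto (fun l => f l x) atTop (𝓝 (F x))) ∧ StrictMono φ ∧
      (∀ k, omega m p (hi m (n (φ k))) f ≤ 2 ^ (1 / p) * (ratio m p (n (φ k)))⁻¹) ∧
      ∀ k, (4 : ℝ≥0∞)⁻¹ * 3⁻¹ ^ (1 / p) ≤
        weakNorm m p (fun x => S m (n (φ k)) f x - F x) := by
  obtain ⟨φ, hφ, hlohi, hh, hdecay⟩ := exists_subsequence m hp1 hn hub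
  set α : ℕ → ℕ := fun k => n (φ k) with hα
  have hα0 : ∀ k, α k ≠ 0 := by
    intro k h0
    have h1 : hi m 0 = 0 := by simp [hi, digit]
    have := hlohi k
    change lo m (α k) < hi m (α k) at this
    rw [h0, h1] at this
    omega
  set h : ℕ → ℕ := fun k => hi m (α k) with hh_def
  set d : ℕ → ℕ := fun k => α k / M m (h k) with hd_def
  have hd : ∀ k, d k ≠ 0 := fun k =>
    (Nat.div_pos (M_hi_le m (hα0 k)) (M_pos m _)).ne'
  have hdm : ∀ k, d k < m (h k) := fun k => by
    rw [hd_def, Nat.div_lt_iff_lt_mul (M_pos m _)]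
    exact lt_M_hi_succ m (α k)
  set w : ℕ → ℝ := fun k => (M m (lo m (α k)) : ℝ) ^ (1 / p - 1) with hw
  set a := blockCoeff m h d w with ha
  have hmart := martingale_psum m a
  have hcoeff : martCoeff m (fun l => psum m a (M m l)) = a := martCoeff_psum m a
  have hterm : ∀ k, (‖w k‖ₑ * (M m (h k) : ℝ≥0∞)) ^ p * (M m (h k) : ℝ≥0∞)⁻¹ =
      decay m p (α k) := fun k => block_term_eq m hp0 hp1 _ _
  have homega : ∀ K, hpNorm m p (fun l x => psum m a (M m l) x -
      psum m a (min (M m (h K)) (M m l)) x) ≤ (2 * decay m p (α K)) ^ (1 / p) := by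
    intro K
    refine (hpNorm_psum_blockCoeff_sub_le m hh hd hdm w (h K) hp0 hp1.le).trans ?_
    simp only [hterm]
    exact ENNReal.rpow_le_rpow (tsum_tail_le hdecay hh K) (by positivity)
  have hF : ∀ {l x}, x ∉ I m l (origin m) →
      limUnder atTop (fun l => psum m a (M m l) x) = psum m a (M m l) x := fun hx =>
    (tendsto_psum_blockCoeff m hh hd hdm w hx).limUnder_eq
  refine ⟨fun l => psum m a (M m l), fun x => limUnder atTop fun l => psum m a (M m l) x, φ,
    ⟨hmart, ?_⟩, ?_, hφ, fun k => ?_, fun k => ?_⟩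
  -- No block begins before `M_{h 0}`, so the tail estimate at `K = 0` bounds the whole `H_p` norm.
  · have hz : ∀ l x, psum m a (min (M m (h 0)) (M m l)) x = 0 := by
      intro l x
      have hle : min (M m (h 0)) (M m l) ≤ M m (h 0) := min_le_left _ _
      rw [psum_blockCoeff m hh hd w le_rfl]
      refine Finset.sum_eq_zero fun k _ => ?_
      have h1 : min (M m (h 0)) (M m l) ≤ d k * M m (h k) :=
        (hle.trans (M_mono m (hh.monotone (Nat.zero_le k)))).trans
          (Nat.le_mul_of_pos_left _ (Nat.pos_of_ne_zero (hd k)))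
      rw [min_eq_left h1, min_eq_left (h1.trans (Nat.mul_le_mul_right _ (Nat.le_succ _)))]
      simp
    have h1 := homega 0
    simp only [hz, sub_zero] at h1
    refine lt_of_le_of_lt h1 (ENNReal.rpow_lt_top_of_nonneg (by positivity) ?_)
    exact ENNReal.mul_ne_top (by norm_num)
      (ne_top_of_le_ne_top ENNReal.one_ne_top (decay_le_one m hp1 (hα0 0)))
  · filter_upwards [ae_exists_notMem_I m] with x hx
    obtain ⟨l, hl⟩ := hx
    rw [hF hl]
    exact tendsto_psum_blockCoeff m hh hd hdm w hl
  · rw [omega_eq m hmart, hcoeff, ← decay_rpow m hp0, ← ENNReal.mul_rpow_of_nonneg _ _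
      (by positivity)]
    exact homega k
  · have hs : lo m (α k) < h k := hlohi k
    refine weakNorm_ge m hp0 (le_haar_lower_set m (digit_lo_ne_zero m (hα0 k))
      (Nat.mod_lt _ (by have := Generator.two_le (m := m) (lo m (α k)); omega))) ?_
    rintro x ⟨hx, hx1⟩
    have hx2 : x ∉ I m (h k) (origin m) := by
      intro h'
      have : rademacher m (lo m (α k)) x = 1 := by
        rw [← rademacher_origin m (lo m (α k)), rademacher_inj]
        exact h' _ hs
      rw [this] at hx1
      norm_num at hx1
    have e : S m (n (φ k)) (fun l => psum m a (M m l)) x = psum m a (α k) x := by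
      rw [S, hcoeff]; rfl
    beta_reduce
    rw [e, hF hx2, psum_blockCoeff_sub_of_mem_block m hh hd hdm w (Nat.div_mul_le_self _ _)
      
        ((Nat.lt_mul_div_succ (α k) (M_pos m (h k))).le.trans_eq (mul_comm _ _)) hx2, norm_mul, Complex.norm_real,
      Real.norm_of_nonneg (by positivity)]
    · exact mul_le_mul_of_nonneg_left (le_norm_dirichlet m hx hx1) (by positivity)

end Divergence

end Vilenkin

theorem mainTheorem2 (p : ℝ) (hp0 : 0 < p) (hp1 : p < 1) :
    (∀ L : ℕ, ∃ c : ℝ≥0, ∀ (m : ℕ → ℕ) [Vilenkin.Generator m], (∀ j, m j ≤ L) →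
      ∀ f : ℕ → Vilenkin.G m → ℂ, Vilenkin.MemHp m p f →
      ∀ k n : ℕ, Vilenkin.M m k < n → n ≤ Vilenkin.M m (k + 1) →
        Vilenkin.errHp m p n f ≤ c * Vilenkin.ratio m p n * Vilenkin.omega m p k f) ∧
    (∀ (m : ℕ → ℕ) [Vilenkin.Generator m], (∃ L : ℕ, ∀ j, m j ≤ L) →
      ∀ f : ℕ → Vilenkin.G m → ℂ, Vilenkin.MemHp m p f →
      ∀ n : ℕ → ℕ, StrictMono n →
        Tendsto (fun k => Vilenkin.omega m p (Vilenkin.hi m (n k)) f *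
          Vilenkin.ratio m p (n k)) atTop (𝓝 0) →
        Tendsto (fun k => Vilenkin.errHp m p (n k) f) atTop (𝓝 0)) ∧
    (∀ (m : ℕ → ℕ) [Vilenkin.Generator m] (n : ℕ → ℕ), StrictMono n →
      ¬ BddAbove (Set.range fun k => Vilenkin.rho m (n k)) →
      ∃ (f : ℕ → Vilenkin.G m → ℂ) (F : Vilenkin.G m → ℂ) (φ : ℕ → ℕ),
        Vilenkin.MemHp m p f ∧
        (∀ᵐ x ∂(Vilenkin.haar m), Tendsto (fun l => f l x) atTop (𝓝 (F x))) ∧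
        StrictMono φ ∧
        (∃ C : ℝ≥0, ∀ᶠ k in atTop,
          Vilenkin.omega m p (Vilenkin.hi m (n (φ k))) f ≤
            C * (Vilenkin.ratio m p (n (φ k)))⁻¹) ∧
        ∃ c : ℝ≥0, 0 < c ∧ (c : ℝ≥0∞) <
          limsup (fun k => Vilenkin.weakNorm m p
            (fun x => Vilenkin.S m (n (φ k)) f x - F x)) atTop) := by
  refine ⟨fun L => ?_, ?_, ?_⟩
  · have hc : Vilenkin.errConst p L ^ (1 / p) ≠ ∞ :=
      ENNReal.rpow_ne_top_of_nonneg (by positivity) (Vilenkin.errConst_ne_top hp0 hp1 L)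
    refine ⟨(Vilenkin.errConst p L ^ (1 / p)).toNNReal, fun m _ hL f hf k n h1 h2 => ?_⟩
    rw [ENNReal.coe_toNNReal hc]
    exact Vilenkin.errHp_le m hp0 hp1 hL hf.1 h1 h2
  · rintro m _ ⟨L, hL⟩ f hf n hn h
    exact Vilenkin.tendsto_errHp m hp0 hp1 hL hf.1 hn h
  · intro m _ n hn hub
    obtain ⟨f, F, φ, hf, hF, hφ, homega, hweak⟩ := Vilenkin.exists_divergent m hp0 hp1 hn hub
    refine ⟨f, F, φ, hf, hF, hφ, ⟨2 ^ (1 / p), Eventually.of_forall fun k => ?_⟩, ?_⟩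
    · rw [ENNReal.coe_rpow_of_nonneg _ (by positivity)]
      exact homega k
    · have hpos : (0 : ℝ≥0∞) < (4 : ℝ≥0∞)⁻¹ * 3⁻¹ ^ (1 / p) :=
        ENNReal.mul_pos (by simp) (by simp)
      -- The limsup is only known to be at least the uniform bound, so a smaller positive `c` gives
      -- strictness.
      obtain ⟨c, hc0, hc⟩ := ENNReal.lt_iff_exists_nnreal_btwn.1 hpos
      refine ⟨c, by exact_mod_cast hc0, hc.trans_le ?_⟩
      exact le_limsup_of_frequently_le (Frequently.of_forall hweak)
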